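/- **Definitions.** An election consists of a finite candidate set $C$ and a finite list $V$ of voters, each of whom has a strict linear preference order on the candidates; when only some candidates run, the preferences are restricted to these. For candidates $a\neq b$ let $\mathrm{netadv}(a,b)$ be the number of voters who prefer $a$ to $b$ minus the number who prefer $b$ to $a$. In the complete directed graph on the running candidates with edge weights $\mathrm{netadv}$, the weight of a path is the smallest weight of its edges, and the strength of $a$ against $b$ is the largest weight of a path from $a$ to $b$. In *Schulze voting*, a candidate $p$ is a winner (not necessarily the unique one) if there is no candidate $a$ whose strength against $p$ is strictly larger than the strength of $p$ against $a$. Consider the following decision problems. * *Destructive control by adding candidates.* Given disjoint candidate sets $C$ and $D$, voters $V$ with preferences over $C\cup D$, a candidate $p\in C$ and $k\in\mathbb N$: is there $D'\subseteq D$ with $|D'|\le k$ such that $p$ is not a Schulze winner of the election $(C\cup D',V)$? * *Destructive control by unlimited adding of candidates.* The same without $k$ and without the bound on $|D'|$. * *Destructive control by deleting candidates.* Given an election $(C,V)$, a candidate $p\in C$ and $k\in\mathbb N$: is there $C'\subseteq C\setminus\{p\}$ with $|C'|\le k$ such that $p$ is not a Schulze winner of the election $(C\setminus C',V)$? * *Path-preserving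 vertex cut.* Given a directed graph $G=(V,E)$, distinct vertices $s,t\in V$ and $k\in\mathbb N$: is there a set $V'\subseteq V$ with $|V'|\le k$ such that the subgraph of $G$ induced on $V\setminus V'$ contains a path from $t$ to $s$ but no path from $s$ to $t$? Instances are encoded as strings in the usual way (voters and candidates are listed one by one, graphs are given by adjacency matrices, and $k$ is written in binary). A problem $A$ *polynomial-time Turing reduces* to a problem $B$ if there is a deterministic oracle Turing machine that, with the set of yes-instances of $B$ as its oracle, decides $A$ in a number of steps bounded by a polynomial in the length of the encoded instance, each oracle query counting as one step. **Proposition.** Each of the three problems destructive control by adding candidates, destructive control by unlimited adding of candidates, and destructive control by deleting candidates, in Schulze voting, polynomial-time Turing reduces to path-preserving vertex cut. -/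

import Mathlib

open Computability

/-! ### Decision problems and polynomial-time Turing reductions -/

/-- The alphabet of all input and query strings: blank, two bits, two brackets, comma. -/
abbrev TMSymbol : Type := Computability.Γ'

/-- A decision problem: a type of instances, each represented by exactly one string over the
fixed alphabet (different instances by different strings), and the set of yes-instances. -/
structure DecisionProblem where
  Inst : Type
  encode : Inst → List TMSymbol
  encode_injective : Function.Injective encode
  Yes : Inst → Prop

/-- The language of a decision problem: the encodings of its yes-instances. -/
def DecisionProblem.language (A : DecisionProblem) : Set (List TMSymbol) :=
  {w | ∃ x : A.Inst, A.encode x = w ∧ A.Yes x}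

/-- A deterministic oracle Turing machine. Its finite control is a program of Mathlib's
multi-stack machine model `Turing.TM2` (finitely many stacks, labels and internal states; a
constant amount of work on the tops of the stacks per step). In addition there is one query
stack and one query label; whenever control is at the query label, the next step consults the
oracle on the content of the query stack and continues at one of two labels according to the
answer, the query stack being emptied. -/
structure OracleTM where
  /-- the index type of the stacks -/
  K : Type
  [decidableEqK : DecidableEq K]
  [fintypeK : Fintype K]
  /-- the stack that holds the input at the start -/
  input : K
  /-- the stack on which oracle queries are written -/
  query : K
  /-- the control labels -/
  Λ : Type
  [fintypeΛ : Fintype Λ]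
  /-- the start label -/
  main : Λ
  /-- the query label -/
  ask : Λ
  /-- the label at which control continues after the given answer of the oracle -/
  onAnswer : Bool → Λ
  /-- the internal states -/
  σ : Type
  [fintypeσ : Fintype σ]
  /-- the initial internal state -/
  start : σ
  /-- the internal states in which a halted machine accepts -/
  accept : Set σ
  /-- the statement executed at each label other than the query label -/
  program : Λ → Turing.TM2.Stmt (fun _ : K => TMSymbol) Λ σ

namespace OracleTM

attribute [instance] OracleTM.decidableEqK OracleTM.fintypeK OracleTM.fintypeΛ
  OracleTM.fintypeσ

/-- Configurations: current label (`none` when halted), internal state, contents of the stacks. -/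
abbrev Cfg (M : OracleTM) : Type :=
  Turing.TM2.Cfg (fun _ : M.K => TMSymbol) M.Λ M.σ

/-- The initial configuration on the input string `w`, whose first symbol is on top. -/
def initCfg (M : OracleTM) (w : List TMSymbol) : M.Cfg where
  l := some M.main
  var := M.start
  stk := Function.update (fun _ => []) M.input w

open Classical in
/-- One computation step with oracle `O`; `none` if the machine has halted. -/
noncomputable def step (M : OracleTM) (O : Set (List TMSymbol)) (c : M.Cfg) : Option M.Cfg :=
  if c.l = some M.ask then
    some { l := some (M.onAnswer (decide (c.stk M.query ∈ O)))
           var := c.var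
           stk := Function.update c.stk M.query [] }
  else Turing.TM2.step M.program c

/-- With oracle `O` and input `w`, the machine halts after at most `t` steps, and it accepts if
and only if `P` holds. -/
def DecidesWithin (M : OracleTM) (O : Set (List TMSymbol)) (w : List TMSymbol) (P : Prop) (t : ℕ) :
    Prop :=
  ∃ c : M.Cfg, Nonempty (StateTransition.EvalsToInTime (M.step O) (M.initCfg w) (some c) t) ∧
    c.l = none ∧ (c.var ∈ M.accept ↔ P)

end OracleTM

/-- `A` polynomial-time Turing reduces to `B`: some oracle Turing machine with oracle (the
language of) `B` decides `A` in time polynomial in the length of the encoded instance. -/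
def PolyTimeTuringReduces (A B : DecisionProblem) : Prop :=
  ∃ (M : OracleTM) (q : Polynomial ℕ), ∀ x : A.Inst,
    M.DecidesWithin B.language (A.encode x) (A.Yes x) (q.eval (A.encode x).length)

/-! ### Encodings -/

/-- The name of the `n`-th candidate or vertex (or the number of all candidates or vertices),
in unary; since these objects are listed one by one in an instance, this changes the length of
an instance only polynomially. -/
def encUnary (n : ℕ) : List TMSymbol :=
  List.replicate n (Γ'.bit true) ++ [Γ'.comma]

/-- A natural number in binary, least significant bit first. -/
def encBinary (n : ℕ) : List TMSymbol :=
  (encodeNat n).map Γ'.bit ++ [Γ'.comma]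

/-- The characteristic bit string of a subset of `Fin m`. -/
def encSet {m : ℕ} (S : Finset (Fin m)) : List TMSymbol :=
  List.ofFn fun i => Γ'.bit (decide (i ∈ S))

/-- A preference order, as the list of the candidates from the best to the worst. -/
def encVote {m : ℕ} (v : Equiv.Perm (Fin m)) : List TMSymbol :=
  (List.ofFn v).flatMap (fun i : Fin m => encUnary i) ++ [Γ'.ket]

/-- The preference orders of all voters, one after the other. -/
def encVotes {m : ℕ} (V : List (Equiv.Perm (Fin m))) : List TMSymbol :=
  V.flatMap encVote

open Classical in
/-- The adjacency matrix of a directed graph, row by row. -/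
noncomputable def encGraph {n : ℕ} (G : Digraph (Fin n)) : List TMSymbol :=
  (List.ofFn fun i => (List.ofFn fun j => Γ'.bit (decide (G.Adj i j))) ++ [Γ'.comma]).flatten

theorem map_bit_comma_inj {a b : List Bool} {l l' : List TMSymbol}
    (h : a.map Γ'.bit ++ (Γ'.comma :: l) = b.map Γ'.bit ++ (Γ'.comma :: l')) :
    a = b ∧ l = l' := by
  induction a generalizing b with
  | nil => cases b <;> simp_all
  | cons x a ih =>
    cases b with
    | nil => simp at h
    | cons y b =>
      simp only [List.map_cons, List.cons_append, List.cons.injEq, Γ'.bit.injEq] at h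
      obtain ⟨h1, h2⟩ := ih h.2
      exact ⟨by rw [h.1, h1], h2⟩

theorem encUnary_inj {a b : ℕ} {l l' : List TMSymbol}
    (h : encUnary a ++ l = encUnary b ++ l') : a = b ∧ l = l' := by
  have h1 : (List.replicate a true).map Γ'.bit ++ (Γ'.comma :: l)
      = (List.replicate b true).map Γ'.bit ++ (Γ'.comma :: l') := by
    simpa [encUnary] using h
  obtain ⟨h2, h3⟩ := map_bit_comma_inj h1
  exact ⟨by simpa using congrArg List.length h2, h3⟩

theorem encBinary_inj {a b : ℕ} {l l' : List TMSymbol}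
    (h : encBinary a ++ l = encBinary b ++ l') : a = b ∧ l = l' := by
  have h1 : (encodeNat a).map Γ'.bit ++ (Γ'.comma :: l)
      = (encodeNat b).map Γ'.bit ++ (Γ'.comma :: l') := by
    simpa [encBinary] using h
  obtain ⟨h2, h3⟩ := map_bit_comma_inj h1
  exact ⟨encodingNatBool.encode_injective h2, h3⟩

theorem encSet_inj {m : ℕ} {S T : Finset (Fin m)} {l l' : List TMSymbol}
    (h : encSet S ++ l = encSet T ++ l') : S = T ∧ l = l' := by
  obtain ⟨h1, h2⟩ := List.append_inj h (by simp [encSet])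
  refine ⟨?_, h2⟩
  have h3 := List.ofFn_injective h1
  ext i
  have := congrFun h3 i
  simpa using this

theorem flatMap_unary_ket_inj {m : ℕ} {a b : List (Fin m)} {l l' : List TMSymbol}
    (h : a.flatMap (fun i : Fin m => encUnary i) ++ (Γ'.ket :: l)
      = b.flatMap (fun i : Fin m => encUnary i) ++ (Γ'.ket :: l')) : a = b ∧ l = l' := by
  have key : ∀ (x : ℕ) (s t : List TMSymbol), encUnary x ++ s ≠ Γ'.ket :: t := by
    intro x s t
    cases x <;> simp [encUnary, List.replicate_succ]
  induction a generalizing b with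
  | nil =>
    cases b with
    | nil => simpa using h
    | cons y b =>
      simp only [List.flatMap_nil, List.nil_append, List.flatMap_cons, List.append_assoc] at h
      exact absurd h.symm (key _ _ _)
  | cons x a ih =>
    cases b with
    | nil =>
      simp only [List.flatMap_nil, List.nil_append, List.flatMap_cons, List.append_assoc] at h
      exact absurd h (key _ _ _)
    | cons y b =>
      simp only [List.flatMap_cons, List.append_assoc] at h
      obtain ⟨h1, h2⟩ := encUnary_inj h
      obtain ⟨h3, h4⟩ := ih h2
      exact ⟨by rw [Fin.ext h1, h3], h4⟩

theorem encVotes_injective {m : ℕ} : Function.Injective (encVotes (m := m)) := by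
  have ne : ∀ (v : Equiv.Perm (Fin m)) (l : List TMSymbol), encVote v ++ l ≠ [] := by
    intro v l
    simp [encVote]
  intro V
  induction V with
  | nil =>
    intro W h
    cases W with
    | nil => rfl
    | cons w W =>
      simp only [encVotes, List.flatMap_nil, List.flatMap_cons] at h
      exact absurd h.symm (ne _ _)
  | cons v V ih =>
    intro W h
    cases W with
    | nil =>
      simp only [encVotes, List.flatMap_nil, List.flatMap_cons] at h
      exact absurd h (ne _ _)
    | cons w W =>
      simp only [encVotes, List.flatMap_cons] at h
      have h1 : (List.ofFn v).flatMap (fun i : Fin m => encUnary i) ++ (Γ'.ket :: V.flatMap encVote)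
          = (List.ofFn w).flatMap (fun i : Fin m => encUnary i) ++ (Γ'.ket :: W.flatMap encVote) := by
        simpa [encVote] using h
      obtain ⟨h2, h3⟩ := flatMap_unary_ket_inj h1
      rw [DFunLike.coe_injective (List.ofFn_injective h2), ih h3]

theorem encGraph_injective {n : ℕ} : Function.Injective (encGraph (n := n)) := by
  classical
  intro G H h
  have aux : ∀ (A B : List (List Bool)),
      (A.map fun r => r.map Γ'.bit ++ [Γ'.comma]).flatten
        = (B.map fun r => r.map Γ'.bit ++ [Γ'.comma]).flatten → A = B := by
    intro A
    induction A with
    | nil => intro B; cases B <;> simp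
    | cons a A ih =>
      intro B hB
      cases B with
      | nil => simp at hB
      | cons b B =>
        simp only [List.map_cons, List.flatten_cons, List.append_assoc, List.cons_append,
          List.nil_append] at hB
        obtain ⟨h1, h2⟩ := map_bit_comma_inj hB
        rw [h1, ih B h2]
  have h1 := aux (List.ofFn fun i => List.ofFn fun j => decide (G.Adj i j))
    (List.ofFn fun i => List.ofFn fun j => decide (H.Adj i j))
    (by simpa [encGraph, List.map_ofFn, Function.comp_def] using h)
  have h2 := List.ofFn_injective h1
  ext i j
  have h3 := congrFun (List.ofFn_injective (congrFun h2 i)) j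
  simpa using h3

/-! ### Schulze voting

The candidates are `Fin m`. A voter is a strict linear order on the candidates, given as the
permutation that maps each position (position `0` being the best) to the candidate there. An
election consists of a set `S` of candidates taking part and a list `V` of voters. -/

/-- The number of voters that rank `a` above `b`. -/
def adv {m : ℕ} (V : List (Equiv.Perm (Fin m))) (a b : Fin m) : ℕ :=
  V.countP fun v => decide (v.symm a < v.symm b)

/-- The net advantage of `a` over `b`. -/
def netadv {m : ℕ} (V : List (Equiv.Perm (Fin m))) (a b : Fin m) : ℤ :=
  (adv V a b : ℤ) - (adv V b a : ℤ)

/-- `l` is (the list of vertices of) a path from `a` to `b` in the complete directed graph on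
the candidates in `S`. -/
def IsElectionPath {m : ℕ} (S : Finset (Fin m)) (a b : Fin m) (l : List (Fin m)) : Prop :=
  l.head? = some a ∧ l.getLast? = some b ∧ l.Nodup ∧ ∀ c ∈ l, c ∈ S

/-- The weight of a path: the least net advantage along its edges (`⊤` if it has no edge). -/
def pathWeight {m : ℕ} (V : List (Equiv.Perm (Fin m))) (l : List (Fin m)) : WithTop ℤ :=
  ((l.zip l.tail).map fun e => (netadv V e.1 e.2 : WithTop ℤ)).foldr min ⊤

/-- `x` is the weight of the strongest path from `a` to `b` in the election `(S, V)`. -/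
def IsPathStrength {m : ℕ} (S : Finset (Fin m)) (V : List (Equiv.Perm (Fin m)))
    (a b : Fin m) (x : WithTop ℤ) : Prop :=
  IsGreatest {w | ∃ l, IsElectionPath S a b l ∧ pathWeight V l = w} x

/-- The best path from `a` to `b` is strictly stronger than the best path from `b` to `a`. -/
def SchulzeBeats {m : ℕ} (S : Finset (Fin m)) (V : List (Equiv.Perm (Fin m)))
    (a b : Fin m) : Prop :=
  ∃ x y, IsPathStrength S V a b x ∧ IsPathStrength S V b a y ∧ y < x

/-- `p` is a (not necessarily unique) winner of the Schulze election `(S, V)`. -/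
def IsSchulzeWinner {m : ℕ} (S : Finset (Fin m)) (V : List (Equiv.Perm (Fin m)))
    (p : Fin m) : Prop :=
  p ∈ S ∧ ∀ a ∈ S, ¬ SchulzeBeats S V a p

/-! ### The control problems -/

/-- Instances of control by adding candidates: the candidates `Fin m` are partitioned into the
registered ones `C` and the addable ones `Cᶜ`. -/
structure AddInst where
  m : ℕ
  C : Finset (Fin m)
  p : Fin m
  p_mem : p ∈ C
  k : ℕ
  V : List (Equiv.Perm (Fin m))

/-- Instances of control by adding an unlimited number of candidates. -/
structure UnlimitedAddInst where
  m : ℕ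
  C : Finset (Fin m)
  p : Fin m
  p_mem : p ∈ C
  V : List (Equiv.Perm (Fin m))

/-- Instances of control by deleting candidates; all of `Fin m` are candidates at first. -/
structure DeleteInst where
  m : ℕ
  p : Fin m
  k : ℕ
  V : List (Equiv.Perm (Fin m))

/-- Destructive control by adding candidates in Schulze voting. -/
def destructiveAdding : DecisionProblem where
  Inst := AddInst
  encode I := encUnary I.m ++ (encSet I.C ++ (encUnary I.p ++ (encBinary I.k ++ encVotes I.V)))
  encode_injective := by
    rintro ⟨m, C, p, hp, k, V⟩ ⟨m', C', p', hp', k', V'⟩ h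
    obtain ⟨h1, h⟩ := encUnary_inj h
    dsimp only at h1
    subst h1
    obtain ⟨h2, h⟩ := encSet_inj h
    obtain ⟨h3, h⟩ := encUnary_inj h
    obtain ⟨h4, h⟩ := encBinary_inj h
    have h5 := encVotes_injective h
    dsimp only at h2 h3 h4 h5
    have h3 := Fin.ext h3
    subst h2 h3 h4 h5
    rfl
  Yes I := ∃ D : Finset (Fin I.m), D ⊆ I.Cᶜ ∧ D.card ≤ I.k ∧ ¬ IsSchulzeWinner (I.C ∪ D) I.V I.p

/-- Destructive control by adding an unlimited number of candidates in Schulze voting. -/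
def destructiveUnlimitedAdding : DecisionProblem where
  Inst := UnlimitedAddInst
  encode I := encUnary I.m ++ (encSet I.C ++ (encUnary I.p ++ encVotes I.V))
  encode_injective := by
    rintro ⟨m, C, p, hp, V⟩ ⟨m', C', p', hp', V'⟩ h
    obtain ⟨h1, h⟩ := encUnary_inj h
    dsimp only at h1
    subst h1
    obtain ⟨h2, h⟩ := encSet_inj h
    obtain ⟨h3, h⟩ := encUnary_inj h
    have h5 := encVotes_injective h
    dsimp only at h2 h3 h5
    have h3 := Fin.ext h3
    subst h2 h3 h5
    rfl
  Yes I := ∃ D : Finset (Fin I.m), D ⊆ I.Cᶜ ∧ ¬ IsSchulzeWinner (I.C ∪ D) I.V I.p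

/-- Destructive control by deleting candidates in Schulze voting. -/
def destructiveDeleting : DecisionProblem where
  Inst := DeleteInst
  encode I := encUnary I.m ++ (encUnary I.p ++ (encBinary I.k ++ encVotes I.V))
  encode_injective := by
    rintro ⟨m, p, k, V⟩ ⟨m', p', k', V'⟩ h
    obtain ⟨h1, h⟩ := encUnary_inj h
    dsimp only at h1
    subst h1
    obtain ⟨h3, h⟩ := encUnary_inj h
    obtain ⟨h4, h⟩ := encBinary_inj h
    have h5 := encVotes_injective h
    dsimp only at h3 h4 h5
    have h3 := Fin.ext h3
    subst h3 h4 h5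
    rfl
  Yes I := ∃ D : Finset (Fin I.m), I.p ∉ D ∧ D.card ≤ I.k ∧ ¬ IsSchulzeWinner Dᶜ I.V I.p

/-! ### Path-preserving vertex cut -/

/-- Instances of path-preserving vertex cut: a directed graph, two distinct vertices and a
deleting limit. -/
structure CutInst where
  n : ℕ
  G : Digraph (Fin n)
  s : Fin n
  t : Fin n
  s_ne_t : s ≠ t
  k : ℕ

/-- The subgraph of `G` induced on the complement of `X` contains a path from `u` to `v`. -/
def HasPathAvoiding {n : ℕ} (G : Digraph (Fin n)) (X : Finset (Fin n)) (u v : Fin n) : Prop :=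
  u ∉ X ∧ v ∉ X ∧ Relation.ReflTransGen (fun x y => G.Adj x y ∧ x ∉ X ∧ y ∉ X) u v

/-- Path-preserving vertex cut: can one delete at most `k` vertices so that a path from `t` to
`s` remains but no path from `s` to `t` does? -/
noncomputable def pathPreservingVertexCut : DecisionProblem where
  Inst := CutInst
  encode I := encUnary I.n ++ (encUnary I.s ++ (encUnary I.t ++ (encBinary I.k ++ encGraph I.G)))
  encode_injective := by
    rintro ⟨n, G, s, t, hst, k⟩ ⟨n', G', s', t', hst', k'⟩ h
    obtain ⟨h1, h⟩ := encUnary_inj h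
    dsimp only at h1
    subst h1
    obtain ⟨h2, h⟩ := encUnary_inj h
    obtain ⟨h3, h⟩ := encUnary_inj h
    obtain ⟨h4, h⟩ := encBinary_inj h
    have h5 := encGraph_injective h
    dsimp only at h2 h3 h4 h5
    have h2 := Fin.ext h2
    have h3 := Fin.ext h3
    subst h2 h3 h4 h5
    rfl
  Yes I := ∃ X : Finset (Fin I.n), X.card ≤ I.k ∧
    HasPathAvoiding I.G X I.t I.s ∧ ¬ HasPathAvoiding I.G X I.s I.t

/-!
A candidate `p` fails to be a Schulze winner if and only if there are a candidate `a ≠ p` and a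
threshold `w` such that, in the graph of the edges with net advantage at least `w`, a walk leads
from `a` to `p` but none from `p` to `a` (`not_isSchulzeWinner_iff`). Only the thresholds between
`1` and the number of voters matter, so a reduction may try all pairs `(a, w)`.

*Deleting.* For fixed `a` and `w`, the candidates to be deleted are exactly a path-preserving vertex
cut of the threshold graph with `s = p` and `t = a`, so one query decides (`Expr.holds_deleting`).

*Adding.* Here candidates have to be chosen, rather than removed, so that the walk from `a` to `p`
appears while no walk from `p` to `a` does. The query is a layered graph (`Layered`) in which
cutting is free and the limit `κ` is built into the layers: the layer of a vertex counts the unregistered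
candidates that the walk has left so far. Each candidate has two copies in each layer; in an
intended solution the second copies that are kept are those of the candidates reachable from `p`,
and the first copies those of the others. Keeping a second copy of `u` and a first copy of `v` is
therefore inadmissible if `u` reaches `v` through registered candidates only, and an edge between
the two copies then closes a walk from `s` to `t`. Whether it has to be there is itself a cut
question with limit `0` (`not_yes_conflictGraph`). Conversely a walk from `p` to `a` splits at the
added candidates into such conflicts, so that the two problems are equivalent
(`exists_added_of_cut`, `exists_cut_of_added`). The number of layers must be polynomial although the
adding limit is given in binary; hence the limit is first compared with the numbers up to that of
all candidates, by queries on bundles of parallel paths (`yes_parallelGraph`).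

*Running time.* The reductions are written in a comprehension language `Expr` whose only form of
iteration is a loop over the positions of a string computed before. Every expression is compiled to
a structured program on stacks (`Cmd`), and this to an oracle Turing machine; a polynomial bound on
the number of steps is obtained by recursion on the expression (`Expr.polyTimeTuringReduces`).

Variables of expressions are named by numerals. The meaning is the same in all expressions for the
control problems: `1` is the number of candidates, `2` the string of registered candidates, `3` the
distinguished candidate, `4` the limit, `5` the votes, `6` the candidate `a`, `7` the threshold,
`8` the unread part of the input, `9` the number of layers; `10` and `11` are two candidates or
vertices, `12` and `13` their layers. All other names serve for auxiliary values.
-/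


/-! ### A structured language of stack commands -/

/-- Structured programs over stacks of symbols that are named by natural numbers. Stack `0` is
the query stack. -/
inductive Cmd : Type
  /-- do nothing -/
  | skip
  /-- push the symbol `c` on stack `k` -/
  | push (k : ℕ) (c : TMSymbol)
  /-- remove the top of stack `k`, if there is one -/
  | pop (k : ℕ)
  /-- move the top of stack `k`, if there is one, to stack `k'` -/
  | move (k k' : ℕ)
  /-- move the top of stack `k`, if there is one, to stack `k₁` and also to stack `k₂` -/
  | dup (k k₁ k₂ : ℕ)
  /-- sequential composition -/
  | seq (a b : Cmd)
  /-- execute `a` if the top of stack `k` is `c` (`none`: if the stack is empty), otherwise `b` -/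
  | ifTop (k : ℕ) (c : Option TMSymbol) (a b : Cmd)
  /-- execute `a` as long as stack `k` is not empty -/
  | loop (k : ℕ) (a : Cmd)
  /-- query the oracle; push a symbol on stack `k` if the answer is positive -/
  | ask (k : ℕ)

namespace Cmd

/-- The contents of all stacks. -/
abbrev Store : Type := ℕ → List TMSymbol

open Classical in
/-- `Exec O c S S' t`: with oracle `O`, the command `c` transforms the store `S` into `S'` in
exactly `t` machine steps. A query takes four of them: going to the query label, the
query itself, and reading and storing its answer. -/
inductive Exec (O : Set (List TMSymbol)) : Cmd → Store → Store → ℕ → Prop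
  | skip (S : Store) : Exec O skip S S 1
  | push (S : Store) (k : ℕ) (c : TMSymbol) :
      Exec O (push k c) S (Function.update S k (c :: S k)) 1
  | pop (S : Store) (k : ℕ) : Exec O (pop k) S (Function.update S k (S k).tail) 1
  | move_nil (S : Store) (k k' : ℕ) : S k = [] → Exec O (move k k') S S 1
  | move_cons (S S₁ : Store) (k k' : ℕ) (c : TMSymbol) (l : List TMSymbol) : S k = c :: l →
      S₁ = Function.update S k l →
      Exec O (move k k') S (Function.update S₁ k' (c :: S₁ k')) 1
  | dup_nil (S : Store) (k k₁ k₂ : ℕ) : S k = [] → Exec O (dup k k₁ k₂) S S 1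
  | dup_cons (S S₁ S₂ : Store) (k k₁ k₂ : ℕ) (c : TMSymbol) (l : List TMSymbol) : S k = c :: l →
      S₁ = Function.update S k l → S₂ = Function.update S₁ k₁ (c :: S₁ k₁) →
      Exec O (dup k k₁ k₂) S (Function.update S₂ k₂ (c :: S₂ k₂)) 1
  | seq {a b : Cmd} {S S' S'' : Store} {m n : ℕ} : Exec O a S S' m → Exec O b S' S'' n →
      Exec O (seq a b) S S'' (m + n)
  | if_pos {k : ℕ} {c : Option TMSymbol} {a b : Cmd} {S S' : Store} {n : ℕ} : (S k).head? = c →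
      Exec O a S S' n → Exec O (ifTop k c a b) S S' (n + 1)
  | if_neg {k : ℕ} {c : Option TMSymbol} {a b : Cmd} {S S' : Store} {n : ℕ} : (S k).head? ≠ c →
      Exec O b S S' n → Exec O (ifTop k c a b) S S' (n + 1)
  | loop_nil {k : ℕ} {a : Cmd} {S : Store} : S k = [] → Exec O (loop k a) S S 1
  | loop_cons {k : ℕ} {a : Cmd} {S S' S'' : Store} {m n : ℕ} : S k ≠ [] → Exec O a S S' m →
      Exec O (loop k a) S' S'' n → Exec O (loop k a) S S'' (m + n + 1)
  | ask (S S₁ : Store) (k : ℕ) : S₁ = Function.update S 0 [] →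
      Exec O (ask k) S
        (if S 0 ∈ O then Function.update S₁ k (Γ'.bit true :: S₁ k) else S₁) 4

/-- The control labels that are needed to execute a command. -/
@[reducible] def Lab : Cmd → Type
  | skip | push _ _ | pop _ | move _ _ | dup _ _ _ => Unit
  | seq a b => a.Lab ⊕ b.Lab
  | ifTop _ _ a b => Option (a.Lab ⊕ b.Lab)
  | loop _ a => Option a.Lab
  | ask _ => Bool

noncomputable instance instFintypeLab : (c : Cmd) → Fintype c.Lab
  | skip | push _ _ | pop _ | move _ _ | dup _ _ _ => inferInstanceAs (Fintype Unit)
  | seq a b => @instFintypeSum _ _ (instFintypeLab a) (instFintypeLab b)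
  | ifTop _ _ a b =>
    @instFintypeOption _ (@instFintypeSum _ _ (instFintypeLab a) (instFintypeLab b))
  | loop _ a => @instFintypeOption _ (instFintypeLab a)
  | ask _ => inferInstanceAs (Fintype Bool)

/-- The label at which the execution of a command starts. -/
def entry : (c : Cmd) → c.Lab
  | skip | push _ _ | pop _ | move _ _ | dup _ _ _ => ()
  | seq a _ => Sum.inl a.entry
  | ifTop _ _ _ _ | loop _ _ => none
  | ask _ => false

/-- All stacks used by a command have names at most `N`. -/
def Below (N : ℕ) : Cmd → Prop
  | skip => True
  | push k _ | pop k | ask k => k ≤ N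
  | move k k' => k ≤ N ∧ k' ≤ N
  | dup k k₁ k₂ => k ≤ N ∧ k₁ ≤ N ∧ k₂ ≤ N
  | seq a b => a.Below N ∧ b.Below N
  | ifTop k _ a b => k ≤ N ∧ a.Below N ∧ b.Below N
  | loop k a => k ≤ N ∧ a.Below N

theorem Below.mono {N N' : ℕ} (h : N ≤ N') {c : Cmd} (hc : c.Below N) : c.Below N' := by
  induction c with
  | skip => trivial
  | seq a b iha ihb => exact ⟨iha hc.1, ihb hc.2⟩
  | ifTop k c a b iha ihb => exact ⟨hc.1.trans h, iha hc.2.1, ihb hc.2.2⟩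
  | loop k a iha => exact ⟨hc.1.trans h, iha hc.2⟩
  | _ => simp only [Below] at *; omega

theorem exists_below (c : Cmd) : ∃ N, c.Below N := by
  induction c with
  | skip => exact ⟨0, trivial⟩
  | push k | pop k | ask k => exact ⟨k, le_rfl⟩
  | move k k' => exact ⟨max k k', by simp [Below]⟩
  | dup k k₁ k₂ => exact ⟨max k (max k₁ k₂), by simp [Below]⟩
  | seq a b iha ihb =>
    obtain ⟨m, hm⟩ := iha
    obtain ⟨n, hn⟩ := ihb
    exact ⟨max m n, hm.mono (le_max_left _ _), hn.mono (le_max_right _ _)⟩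
  | ifTop k c a b iha ihb =>
    obtain ⟨m, hm⟩ := iha
    obtain ⟨n, hn⟩ := ihb
    exact ⟨max k (max m n), le_max_left _ _, hm.mono (by simp), hn.mono (by simp)⟩
  | loop k a iha =>
    obtain ⟨m, hm⟩ := iha
    exact ⟨max k m, le_max_left _ _, hm.mono (le_max_right _ _)⟩

/-! ### Compilation of stack commands to oracle Turing machines -/

/-- The statements of the multi-stack machine that execute stack commands. The internal state
consists of a register for one symbol and of the label at which control is to continue after
an oracle query. -/
abbrev Code (N : ℕ) (Λ : Type) : Type :=
  Turing.TM2.Stmt (fun _ : Fin (N + 1) => TMSymbol) Λ (Option TMSymbol × Λ)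

open Turing.TM2.Stmt in
/-- The statements executing a command, for a given embedding `f` of its labels into those of
the machine, exit label and query label. -/
def code (N : ℕ) {Λ : Type} (query : Λ) : (c : Cmd) → (c.Lab → Λ) → Λ → c.Lab → Code N Λ
  | skip, _, exit => fun _ => goto fun _ => exit
  | push k c, _, exit => fun _ =>
    Turing.TM2.Stmt.push (Fin.ofNat _ k) (fun _ => c) (goto fun _ => exit)
  | pop k, _, exit => fun _ =>
    Turing.TM2.Stmt.pop (Fin.ofNat _ k) (fun v _ => v) (goto fun _ => exit)
  | move k k', _, exit => fun _ =>
    Turing.TM2.Stmt.pop (Fin.ofNat _ k) (fun v o => (o, v.2))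
      (branch (fun v => v.1.isSome)
        (Turing.TM2.Stmt.push (Fin.ofNat _ k') (fun v => v.1.getD Γ'.blank) (goto fun _ => exit))
        (goto fun _ => exit))
  | dup k k₁ k₂, _, exit => fun _ =>
    Turing.TM2.Stmt.pop (Fin.ofNat _ k) (fun v o => (o, v.2))
      (branch (fun v => v.1.isSome)
        (Turing.TM2.Stmt.push (Fin.ofNat _ k₁) (fun v => v.1.getD Γ'.blank)
          (Turing.TM2.Stmt.push (Fin.ofNat _ k₂) (fun v => v.1.getD Γ'.blank) (goto fun _ => exit)))
        (goto fun _ => exit))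
  | seq a b, f, exit => fun l =>
    match l with
    | Sum.inl l => code N query a (fun x => f (Sum.inl x)) (f (Sum.inr b.entry)) l
    | Sum.inr l => code N query b (fun x => f (Sum.inr x)) exit l
  | ifTop k c a b, f, exit => fun l =>
    match l with
    | none =>
      peek (Fin.ofNat _ k) (fun v o => (o, v.2))
        (branch (fun v => decide (v.1 = c)) (goto fun _ => f (some (Sum.inl a.entry)))
          (goto fun _ => f (some (Sum.inr b.entry))))
    | some (Sum.inl l) => code N query a (fun x => f (some (Sum.inl x))) exit l
    | some (Sum.inr l) => code N query b (fun x => f (some (Sum.inr x))) exit l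
  | loop k a, f, exit => fun l =>
    match l with
    | none =>
      peek (Fin.ofNat _ k) (fun v o => (o, v.2))
        (branch (fun v => v.1.isSome) (goto fun _ => f (some a.entry)) (goto fun _ => exit))
    | some l => code N query a (fun x => f (some x)) (f none) l
  | ask k, f, exit => fun l =>
    match l with
    | false => load (fun v => (v.1, f true)) (goto fun _ => query)
    | true =>
      branch (fun v => v.1.isSome)
        (Turing.TM2.Stmt.push (Fin.ofNat _ k) (fun _ => Γ'.bit true) (goto fun _ => exit))
        (goto fun _ => exit)

/-- The labels of the machine executing `c`: those of `c`, two labels for the answers of the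
oracle, the query label `Sum.inr (Sum.inr true)`, and a final label `Sum.inr (Sum.inr false)`. -/
abbrev MachineLab (c : Cmd) : Type := c.Lab ⊕ (Bool ⊕ Bool)

/-- The internal states of the machine executing `c`. -/
abbrev MachineState (c : Cmd) : Type := Option TMSymbol × c.MachineLab

/-- The configurations of the machine executing `c`. -/
abbrev MachineCfg (N : ℕ) (c : Cmd) : Type :=
  Turing.TM2.Cfg (fun _ : Fin (N + 1) => TMSymbol) c.MachineLab c.MachineState

open Turing.TM2.Stmt in
/-- The program of the machine executing `c`. -/
def machineCode (N : ℕ) (c : Cmd) : c.MachineLab → Code N c.MachineLab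
  | Sum.inl l => code N (Sum.inr (Sum.inr true)) c Sum.inl (Sum.inr (Sum.inr false)) l
  | Sum.inr (Sum.inl b) =>
    load (fun v => (if b then some (Γ'.bit true) else none, v.2)) (goto fun v => v.2)
  | Sum.inr (Sum.inr _) => Turing.TM2.Stmt.pop (Fin.ofNat _ 2) (fun v o => (o, v.2)) halt

/-- The oracle machine that executes `c` with the input on stack `1` and accepts if stack `2` is
not empty at the end. -/
noncomputable def machine (N : ℕ) (c : Cmd) : OracleTM where
  K := Fin (N + 1)
  input := Fin.ofNat _ 1
  query := Fin.ofNat _ 0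
  Λ := c.MachineLab
  main := Sum.inl c.entry
  ask := Sum.inr (Sum.inr true)
  onAnswer b := Sum.inr (Sum.inl b)
  σ := c.MachineState
  start := (none, Sum.inl c.entry)
  accept := {v | v.1.isSome}
  program := machineCode N c

/-- The stacks of the machine that represent a given store. -/
def Store.stk (N : ℕ) (S : Store) : Fin (N + 1) → List TMSymbol := fun k => S k

theorem stk_ofNat {N k : ℕ} (hk : k ≤ N) (S : Store) : Store.stk N S (Fin.ofNat _ k) = S k := by
  simp [Store.stk, Nat.mod_eq_of_lt (Nat.lt_succ_of_le hk)]

theorem update_stk {N k : ℕ} (hk : k ≤ N) (S : Store) (l : List TMSymbol) :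
    Function.update (Store.stk N S) (Fin.ofNat _ k) l = Store.stk N (Function.update S k l) := by
  funext j
  have : (j = Fin.ofNat _ k) ↔ (j : ℕ) = k := by
    rw [Fin.ext_iff]
    simp [Nat.mod_eq_of_lt (Nat.lt_succ_of_le hk)]
  simp only [Store.stk, Function.update_apply, this]

open Classical in
/-- The step function of the machine executing `c`. -/
noncomputable def machineStep (N : ℕ) (c : Cmd) (O : Set (List TMSymbol)) (x : MachineCfg N c) :
    Option (MachineCfg N c) :=
  if x.l = some (Sum.inr (Sum.inr true)) then
    some { l := some (Sum.inr (Sum.inl (decide (x.stk (Fin.ofNat _ 0) ∈ O))))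
           var := x.var
           stk := Function.update x.stk (Fin.ofNat _ 0) [] }
  else Turing.TM2.step (machineCode N c) x

theorem machine_step (N : ℕ) (c : Cmd) (O : Set (List TMSymbol)) :
    (machine N c).step O = machineStep N c O := by
  funext x
  unfold OracleTM.step machineStep
  congr

/-- The machine executing `c` gets from configuration `x` to configuration `y` in `n` steps. -/
def Reach {N : ℕ} {c : Cmd} (O : Set (List TMSymbol)) (x y : MachineCfg N c) (n : ℕ) : Prop :=
  (flip bind (machineStep N c O))^[n] (some x) = some y

variable {N : ℕ} {w : Cmd}

theorem reach_one {O : Set (List TMSymbol)} {x y : MachineCfg N w}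
    (h : machineStep N w O x = some y) : Reach O x y 1 := h

theorem Reach.trans {O : Set (List TMSymbol)} {x y z : MachineCfg N w} {m n : ℕ}
    (h : Reach O x y m) (h' : Reach O y z n) : Reach O x z (m + n) := by
  unfold Reach at *
  rw [Nat.add_comm, Function.iterate_add_apply, h, h']

/-- A step of the machine at a label other than the query label. -/
theorem reach_step {O : Set (List TMSymbol)} {l : w.MachineLab} (hl : l ≠ Sum.inr (Sum.inr true))
    (v : w.MachineState) (S : Fin (N + 1) → List TMSymbol) :
    Reach O (⟨some l, v, S⟩ : MachineCfg N w) (Turing.TM2.stepAux (machineCode N w l) v S) 1 := by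
  apply reach_one
  simp [machineStep, hl]

open Classical in
/-- A step of the machine at the query label. -/
theorem reach_query {O : Set (List TMSymbol)} (v : w.MachineState) (S : Store) :
    Reach O (⟨some (Sum.inr (Sum.inr true)), v, Store.stk N S⟩ : MachineCfg N w)
      ⟨some (Sum.inr (Sum.inl (decide (S 0 ∈ O)))), v, Store.stk N (Function.update S 0 [])⟩ 1 := by
  apply reach_one
  have h := stk_ofNat (Nat.zero_le N) S
  simp only [machineStep, ← update_stk (Nat.zero_le N), h, if_true]

open Classical in
/-- The machine simulates every command whose code is part of its program. -/
theorem reach_of_exec {O : Set (List TMSymbol)} {c : Cmd} {S S' : Store} {t : ℕ}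
    (h : Exec O c S S' t) (hN : c.Below N) (f : c.Lab → w.MachineLab) (exit : w.MachineLab)
    (hf : ∀ l, f l ≠ Sum.inr (Sum.inr true))
    (hp : ∀ l, machineCode N w (f l) = code N (Sum.inr (Sum.inr true)) c f exit l)
    (v : w.MachineState) :
    ∃ v', Reach O (⟨some (f c.entry), v, Store.stk N S⟩ : MachineCfg N w)
      ⟨some exit, v', Store.stk N S'⟩ t := by
  induction h generalizing exit v with
  | skip S =>
    have h := reach_step (N := N) (O := O) (hf ()) v (Store.stk N S)
    rw [hp ()] at h
    exact ⟨_, h⟩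
  | push S k c =>
    have h := reach_step (N := N) (O := O) (hf ()) v (Store.stk N S)
    rw [hp ()] at h
    simp only [code, Turing.TM2.stepAux] at h
    rw [update_stk hN, stk_ofNat hN] at h
    exact ⟨_, h⟩
  | pop S k =>
    have h := reach_step (N := N) (O := O) (hf ()) v (Store.stk N S)
    rw [hp ()] at h
    simp only [code, Turing.TM2.stepAux] at h
    rw [update_stk hN, stk_ofNat hN] at h
    exact ⟨_, h⟩
  | move_nil S k k' hk =>
    have h := reach_step (N := N) (O := O) (hf ()) v (Store.stk N S)
    rw [hp ()] at h
    simp only [code, Turing.TM2.stepAux] at h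
    have hu : Function.update S k [] = S := by rw [← hk, Function.update_eq_self]
    simp only [update_stk hN.1, stk_ofNat hN.1, hk, hu, List.head?_nil, List.tail_nil,
      Option.isSome_none, cond_false] at h
    exact ⟨_, h⟩
  | move_cons S S₁ k k' c l hk h₁ =>
    have h := reach_step (N := N) (O := O) (hf ()) v (Store.stk N S)
    rw [hp ()] at h
    simp only [code, Turing.TM2.stepAux] at h
    simp only [update_stk hN.1, stk_ofNat hN.1, hk, List.head?_cons, List.tail_cons,
      Option.isSome_some, cond_true, Option.getD_some] at h
    rw [← h₁, update_stk hN.2, stk_ofNat hN.2] at h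
    exact ⟨_, h⟩
  | dup_nil S k k₁ k₂ hk =>
    have h := reach_step (N := N) (O := O) (hf ()) v (Store.stk N S)
    rw [hp ()] at h
    simp only [code, Turing.TM2.stepAux] at h
    have hu : Function.update S k [] = S := by rw [← hk, Function.update_eq_self]
    simp only [update_stk hN.1, stk_ofNat hN.1, hk, hu, List.head?_nil, List.tail_nil,
      Option.isSome_none, cond_false] at h
    exact ⟨_, h⟩
  | dup_cons S S₁ S₂ k k₁ k₂ c l hk h₁ h₂ =>
    have h := reach_step (N := N) (O := O) (hf ()) v (Store.stk N S)
    rw [hp ()] at h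
    simp only [code, Turing.TM2.stepAux] at h
    simp only [update_stk hN.1, stk_ofNat hN.1, hk, List.head?_cons, List.tail_cons,
      Option.isSome_some, cond_true, Option.getD_some] at h
    rw [← h₁, update_stk hN.2.1, stk_ofNat hN.2.1, ← h₂, update_stk hN.2.2,
      stk_ofNat hN.2.2] at h
    exact ⟨_, h⟩
  | @seq a b S S' S'' m n _ _ iha ihb =>
    obtain ⟨v', h'⟩ := iha hN.1 (fun x => f (Sum.inl x)) (f (Sum.inr b.entry)) (fun _ => hf _)
      (fun l => hp (Sum.inl l)) v
    obtain ⟨v'', h''⟩ := ihb hN.2 (fun x => f (Sum.inr x)) exit (fun _ => hf _)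
      (fun l => hp (Sum.inr l)) v'
    exact ⟨v'', h'.trans h''⟩
  | @if_pos k c a b S S' n hk _ ih =>
    have h := reach_step (N := N) (O := O) (hf none) v (Store.stk N S)
    rw [hp none] at h
    simp only [code, Turing.TM2.stepAux] at h
    rw [stk_ofNat hN.1, hk] at h
    obtain ⟨v', h'⟩ := ih hN.2.1 (fun x => f (some (Sum.inl x))) exit (fun _ => hf _)
      (fun l => hp (some (Sum.inl l))) (c, v.2)
    rw [Nat.add_comm n]
    refine ⟨v', Reach.trans ?_ h'⟩
    simp only [decide_true, cond_true] at h
    exact h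
  | @if_neg k c a b S S' n hk _ ih =>
    have h := reach_step (N := N) (O := O) (hf none) v (Store.stk N S)
    rw [hp none] at h
    simp only [code, Turing.TM2.stepAux] at h
    rw [stk_ofNat hN.1] at h
    obtain ⟨v', h'⟩ := ih hN.2.2 (fun x => f (some (Sum.inr x))) exit (fun _ => hf _)
      (fun l => hp (some (Sum.inr l))) ((S k).head?, v.2)
    rw [Nat.add_comm n]
    refine ⟨v', Reach.trans ?_ h'⟩
    simp only [hk, decide_false, cond_false] at h
    exact h
  | @loop_nil k a S hk =>
    have h := reach_step (N := N) (O := O) (hf none) v (Store.stk N S)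
    rw [hp none] at h
    simp only [code, Turing.TM2.stepAux] at h
    rw [stk_ofNat hN.1, hk] at h
    exact ⟨_, h⟩
  | @loop_cons k a S S' S'' m n hk _ _ iha ihl =>
    have h := reach_step (N := N) (O := O) (hf none) v (Store.stk N S)
    rw [hp none] at h
    simp only [code, Turing.TM2.stepAux] at h
    rw [stk_ofNat hN.1] at h
    obtain ⟨v', h'⟩ := iha hN.2 (fun x => f (some x)) (f none) (fun _ => hf _)
      (fun l => hp (some l)) ((S k).head?, v.2)
    obtain ⟨v'', h''⟩ := ihl hN f exit hf hp v'
    refine ⟨v'', ?_⟩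
    rw [show m + n + 1 = 1 + m + n by ring]
    refine Reach.trans (Reach.trans ?_ h') h''
    have hs : (S k).head?.isSome = true := by
      cases hS : S k with
      | nil => exact absurd hS hk
      | cons c l => rfl
    simp only [hs, cond_true] at h
    exact h
  | ask S S₁ k h₁ =>
    have e1 := reach_step (N := N) (O := O) (hf false) v (Store.stk N S)
    rw [hp false] at e1
    have e2 := reach_query (N := N) (O := O) (v.1, f true) S
    have e3 := reach_step (N := N) (w := w) (O := O) (l := Sum.inr (Sum.inl (decide (S 0 ∈ O))))
      (by simp) (v.1, f true) (Store.stk N S₁)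
    have e4 := reach_step (N := N) (O := O) (hf true)
      (if S 0 ∈ O then some (Γ'.bit true) else none, f true) (Store.stk N S₁)
    rw [hp true] at e4
    rw [← h₁] at e2
    by_cases hO : S 0 ∈ O
    · simp only [hO, if_true, decide_true, code, machineCode, Turing.TM2.stepAux,
        Option.isSome_some, cond_true, update_stk hN, stk_ofNat hN] at *
      exact ⟨_, ((e1.trans e2).trans e3).trans e4⟩
    · simp only [hO, if_false, decide_false, code, machineCode, Turing.TM2.stepAux,
        Option.isSome_none, cond_false, Bool.false_eq_true] at *
      exact ⟨_, ((e1.trans e2).trans e3).trans e4⟩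

/-- If the command `c` is executed in `t` steps, then the machine executing it decides within one
more step whether stack `2` is nonempty at the end. -/
theorem decidesWithin_machine {O : Set (List TMSymbol)} {c : Cmd} (hN : c.Below N) (hN2 : 2 ≤ N)
    {x : List TMSymbol} {S' : Store} {t T : ℕ}
    (h : Exec O c (Function.update (fun _ => []) 1 x) S' t) (hT : t + 1 ≤ T) :
    (machine N c).DecidesWithin O x (S' 2 ≠ []) T := by
  obtain ⟨v', h'⟩ := reach_of_exec (w := c) h hN Sum.inl (Sum.inr (Sum.inr false)) (by simp)
    (fun _ => rfl) (none, Sum.inl c.entry)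
  have h2 := reach_step (N := N) (O := O) (w := c) (l := Sum.inr (Sum.inr false)) (by simp) v'
    (Store.stk N S')
  have h3 := h'.trans h2
  have hi : (machine N c).initCfg x = ⟨some (Sum.inl c.entry), (none, Sum.inl c.entry),
      Store.stk N (Function.update (fun _ => []) 1 x)⟩ := by
    rw [← update_stk (by omega)]
    rfl
  refine ⟨Turing.TM2.stepAux (machineCode N c (Sum.inr (Sum.inr false))) v' (Store.stk N S'),
    ⟨⟨⟨t + 1, ?_⟩, hT⟩⟩, rfl, ?_⟩
  · rw [hi, machine_step]
    exact h3
  change ((Store.stk N S' (Fin.ofNat _ 2)).head?.isSome = true) ↔ _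
  rw [stk_ofNat hN2]
  cases S' 2 <;> simp

end Cmd

/-! ### A comprehension language for oracle computations -/

/-- Expressions that denote strings depending on the string values of variables, which are named
by natural numbers. Iteration is possible only over the positions of a string that has been
computed before, and its results are concatenated; hence every expression can be evaluated in
polynomial time. A string is used as a truth value: the empty string is false, any other is
true. -/
inductive Expr : Type
  /-- the empty string -/
  | nil
  /-- the string consisting of the symbol `c` -/
  | sym (c : TMSymbol)
  /-- the value of the variable `x` -/
  | var (x : ℕ)
  /-- the first symbol of the value of `x` -/
  | head (x : ℕ)
  /-- the test whether the value of `x` begins with `c` -/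
  | hd (x : ℕ) (c : TMSymbol)
  /-- concatenation -/
  | app (a b : Expr)
  /-- the value of `a` without as many symbols at its beginning as the value of `b` has -/
  | drop (a b : Expr)
  /-- the value of `b` if that of `a` is true, otherwise the value of `c` -/
  | ite (a b c : Expr)
  /-- the value of `b` when `x` has the value of `a` -/
  | letE (x : ℕ) (a b : Expr)
  /-- for each position in the value of `a`, the value of `b` when `x` is the part before that
  position, reversed, and `y` is the part from that position on -/
  | zip (x y : ℕ) (a b : Expr)
  /-- the answer of the oracle to the value of `a` -/
  | ask (a : Expr)

namespace Expr

/-- The pairs consisting of a proper prefix of `l`, reversed and put before `acc`, and of the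
rest of `l`. -/
def splits : List TMSymbol → List TMSymbol → List (List TMSymbol × List TMSymbol)
  | _, [] => []
  | acc, c :: l => (acc, c :: l) :: splits (c :: acc) l

open Classical in
/-- The value of an expression, for a given oracle and given values of the variables. -/
noncomputable def eval (O : Set (List TMSymbol)) : Expr → (ℕ → List TMSymbol) → List TMSymbol
  | nil, _ => []
  | sym c, _ => [c]
  | var x, env => env x
  | head x, env => (env x).take 1
  | hd x c, env => if (env x).head? = some c then [Γ'.bit true] else []
  | app a b, env => a.eval O env ++ b.eval O env
  | drop a b, env => (a.eval O env).drop (b.eval O env).length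
  | ite a b c, env => if a.eval O env = [] then c.eval O env else b.eval O env
  | letE x a b, env => b.eval O (Function.update env x (a.eval O env))
  | zip x y a b, env => (splits [] (a.eval O env)).flatMap fun p =>
      b.eval O (Function.update (Function.update env x p.1) y p.2)
  | ask a, env => if a.eval O env ∈ O then [Γ'.bit true] else []

open Polynomial in
/-- A polynomial bound on the length of the value of an expression in terms of the maximal
length of the values of the variables. -/
noncomputable def size : Expr → Polynomial ℕ
  | nil => 0
  | sym _ | head _ | hd _ _ | ask _ => 1
  | var _ => X
  | app a b => a.size + b.size
  | drop a _ => a.size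
  | ite _ b c => b.size + c.size
  | letE _ a b => b.size.comp (X + a.size)
  | zip _ _ a b => a.size * b.size.comp (X + a.size)

open Polynomial in
/-- A polynomial bound on the number of steps needed to evaluate an expression, in terms of the
maximal length of the values of the variables. -/
noncomputable def cost : Expr → Polynomial ℕ
  | nil | sym _ => 1
  | var _ => 4 * X + 2
  | head _ | hd _ _ => 2
  | app a b => a.cost + b.cost
  | drop a b => (a.cost + (2 * a.size + 1)) + (b.cost + ((3 * b.size + 1) + (2 * a.size + 1)))
  | ite a b c => a.cost + (((2 * a.size + 1 + b.cost) + c.cost) + 1)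
  | letE _ a b =>
    (a.cost + (2 * a.size + 1)) + (b.cost.comp (X + a.size) + (2 * a.size + 1))
  | zip _ _ a b =>
    (a.cost + (2 * a.size + 1)) + ((a.size * (b.cost.comp (X + a.size) + 2) + 1) +
      (2 * a.size + 1))
  | ask a => a.cost + ((2 * a.size + 1) + 4)

theorem length_splits (acc l : List TMSymbol) : (splits acc l).length = l.length := by
  induction l generalizing acc with
  | nil => rfl
  | cons c l ih => simp [splits, ih]

theorem length_le_of_mem_splits {acc l : List TMSymbol} {p : List TMSymbol × List TMSymbol}
    (h : p ∈ splits acc l) :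
    p.1.length ≤ acc.length + l.length ∧ p.2.length ≤ acc.length + l.length := by
  induction l generalizing acc with
  | nil => simp [splits] at h
  | cons c l ih =>
    simp only [splits, List.mem_cons] at h
    rcases h with rfl | h
    · simp
    · have := ih h
      simp only [List.length_cons] at *
      omega

theorem update_length_le {env : ℕ → List TMSymbol} {x : ℕ} {l : List TMSymbol} {n m : ℕ}
    (h : ∀ x, (env x).length ≤ n) (hl : l.length ≤ m) (y : ℕ) :
    (Function.update env x l y).length ≤ n + m := by
  have := h y
  rw [Function.update_apply]
  split <;> omega

theorem update₂_length_le {env : ℕ → List TMSymbol} {x x' : ℕ} {l l' : List TMSymbol} {n m : ℕ}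
    (h : ∀ x, (env x).length ≤ n) (hl : l.length ≤ m) (hl' : l'.length ≤ m) (y : ℕ) :
    (Function.update (Function.update env x l) x' l' y).length ≤ n + m := by
  have := h y
  simp only [Function.update_apply]
  split
  · omega
  · split <;> omega

theorem length_flatMap_le {α : Type*} (l : List α) (f : α → List TMSymbol) (n : ℕ)
    (h : ∀ x ∈ l, (f x).length ≤ n) : (l.flatMap f).length ≤ l.length * n := by
  induction l with
  | nil => simp
  | cons a l ih =>
    have h1 := h a (by simp)
    have h2 := ih fun x hx => h x (by simp [hx])
    simp only [List.flatMap_cons, List.length_append, List.length_cons, Nat.add_mul, Nat.one_mul]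
    omega

theorem length_eval_le (O : Set (List TMSymbol)) (e : Expr) {env : ℕ → List TMSymbol} {n : ℕ}
    (h : ∀ x, (env x).length ≤ n) : (e.eval O env).length ≤ e.size.eval n := by
  induction e generalizing env n with
  | nil => simp [eval, size]
  | sym c => simp [eval, size]
  | var x => simpa [eval, size] using h x
  | head x => simp [eval, size]
  | hd x c => simp only [eval, size]; split <;> simp
  | app a b iha ihb =>
    have := iha h
    have := ihb h
    simp only [eval, size, List.length_append, Polynomial.eval_add]
    omega
  | drop a b iha ihb =>
    have := iha h
    simp only [eval, size, List.length_drop]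
    omega
  | ite a b c iha ihb ihc =>
    have := ihb h
    have := ihc h
    simp only [eval, size, Polynomial.eval_add]
    split <;> omega
  | letE x a b iha ihb =>
    simp only [eval, size, Polynomial.eval_comp, Polynomial.eval_add, Polynomial.eval_X]
    exact ihb (update_length_le h (iha h))
  | zip x y a b iha ihb =>
    simp only [eval, size, Polynomial.eval_comp, Polynomial.eval_add, Polynomial.eval_X,
      Polynomial.eval_mul]
    refine (length_flatMap_le _ _ _ fun p hp => ihb ?_).trans
      (Nat.mul_le_mul_right _ ((length_splits _ _).trans_le (iha h)))
    have h1 := length_le_of_mem_splits hp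
    have h2 := iha h
    simp only [List.length_nil, Nat.zero_add] at h1
    exact update₂_length_le h (h1.1.trans h2) (h1.2.trans h2)
  | ask a iha => simp only [eval, size]; split <;> simp

/-! ### Compilation of expressions to stack commands -/

open Cmd in
/-- The command that pushes the value of an expression on stack `o`, symbol by symbol. The value
of the variable `x` is on stack `ρ x`, and the stacks from `d` on are free for temporary use. -/
def comp : Expr → (ℕ → ℕ) → ℕ → ℕ → Cmd
  | nil, _, _, _ => skip
  | sym c, _, _, o => push o c
  | var x, ρ, d, o => seq (loop (ρ x) (dup (ρ x) o d)) (loop d (move d (ρ x)))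
  | head x, ρ, d, o => seq (dup (ρ x) o d) (move d (ρ x))
  | hd x c, ρ, _, o => ifTop (ρ x) (some c) (push o (Γ'.bit true)) skip
  | app a b, ρ, d, o => seq (a.comp ρ d o) (b.comp ρ d o)
  | drop a b, ρ, d, o =>
    seq (seq (a.comp ρ (d + 1) d) (loop d (move d (d + 1))))
      (seq (b.comp ρ (d + 2) d) (seq (loop d (seq (pop d) (pop (d + 1))))
        (loop (d + 1) (move (d + 1) o))))
  | ite a b c, ρ, d, o =>
    seq (a.comp ρ (d + 1) d)
      (ifTop d none (c.comp ρ d o) (seq (loop d (pop d)) (b.comp ρ d o)))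
  | letE x a b, ρ, d, o =>
    seq (seq (a.comp ρ (d + 1) d) (loop d (move d (d + 1))))
      (seq (b.comp (Function.update ρ x (d + 1)) (d + 2) o) (loop (d + 1) (pop (d + 1))))
  | zip x y a b, ρ, d, o =>
    seq (seq (a.comp ρ (d + 1) d) (loop d (move d (d + 1))))
      (seq (loop (d + 1)
        (seq (b.comp (Function.update (Function.update ρ x d) y (d + 1)) (d + 2) o)
          (move (d + 1) d))) (loop d (pop d)))
  | ask a, ρ, d, o =>
    seq (a.comp ρ (d + 1) d) (seq (loop d (move d 0)) (Cmd.ask o))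

open Cmd

variable {O : Set (List TMSymbol)}

theorem Exec.of_eq {c : Cmd} {S S' S'' : Store} {t : ℕ} (h : Exec O c S S' t) (e : S' = S'') :
    Exec O c S S'' t := e ▸ h

theorem exec_move {S : Store} {k k' : ℕ} {c : TMSymbol} {l : List TMSymbol} (h : S k = c :: l)
    (hk : k ≠ k') :
    Exec O (move k k') S (Function.update (Function.update S k l) k' (c :: S k')) 1 := by
  refine Exec.of_eq (Exec.move_cons S _ k k' c l h rfl) ?_
  rw [Function.update_of_ne hk.symm]

theorem exec_loop_move {k k' : ℕ} (hk : k ≠ k') (l : List TMSymbol) : ∀ S : Store, S k = l →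
    Exec O (loop k (move k k')) S
      (Function.update (Function.update S k []) k' (l.reverse ++ S k')) (2 * l.length + 1) := by
  induction l with
  | nil =>
    intro S h
    refine Exec.of_eq (Exec.loop_nil h) ?_
    funext j
    simp only [Function.update_apply]
    grind
  | cons c l ih =>
    intro S h
    have h1 := ih (Function.update (Function.update S k l) k' (c :: S k')) (by simp [hk])
    have h2 := Exec.loop_cons (by simp [h]) (exec_move h hk) h1
    have ht : 1 + (2 * l.length + 1) + 1 = 2 * (c :: l).length + 1 := by simp; ring
    rw [ht] at h2
    refine Exec.of_eq h2 ?_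
    funext j
    simp only [Function.update_apply]
    grind

theorem exec_loop_pop {k : ℕ} (l : List TMSymbol) : ∀ S : Store, S k = l →
    Exec O (loop k (pop k)) S (Function.update S k []) (2 * l.length + 1) := by
  induction l with
  | nil =>
    intro S h
    refine Exec.of_eq (Exec.loop_nil h) ?_
    rw [← h, Function.update_eq_self]
  | cons c l ih =>
    intro S h
    have h1 := ih (Function.update S k (S k).tail) (by simp [h])
    have h2 := Exec.loop_cons (by simp [h]) (Exec.pop S k) h1
    have ht : 1 + (2 * l.length + 1) + 1 = 2 * (c :: l).length + 1 := by simp; ring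
    rw [ht] at h2
    exact Exec.of_eq h2 (by simp)

theorem exec_loop_dup {k k₁ k₂ : ℕ} (h₁ : k ≠ k₁) (h₂ : k ≠ k₂) (h₃ : k₁ ≠ k₂)
    (l : List TMSymbol) : ∀ S : Store, S k = l →
    Exec O (loop k (dup k k₁ k₂)) S
      (Function.update (Function.update (Function.update S k []) k₁ (l.reverse ++ S k₁)) k₂
        (l.reverse ++ S k₂)) (2 * l.length + 1) := by
  induction l with
  | nil =>
    intro S h
    refine Exec.of_eq (Exec.loop_nil h) ?_
    funext j
    simp only [Function.update_apply]
    grind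
  | cons c l ih =>
    intro S h
    have h0 := Exec.dup_cons (O := O) S _ _ k k₁ k₂ c l h rfl rfl
    have h2 := Exec.loop_cons (by simp [h]) h0 (ih _ (by simp [h₁, h₂]))
    have ht : 1 + (2 * l.length + 1) + 1 = 2 * (c :: l).length + 1 := by simp; ring
    rw [ht] at h2
    refine Exec.of_eq h2 ?_
    funext j
    simp only [Function.update_apply]
    grind

theorem exec_loop_pop_pop {k k' : ℕ} (hk : k ≠ k') (l : List TMSymbol) : ∀ S : Store, S k = l →
    Exec O (loop k (seq (pop k) (pop k'))) S
      (Function.update (Function.update S k []) k' ((S k').drop l.length)) (3 * l.length + 1) := by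
  induction l with
  | nil =>
    intro S h
    refine Exec.of_eq (Exec.loop_nil h) ?_
    funext j
    simp only [Function.update_apply]
    grind
  | cons c l ih =>
    intro S h
    have h0 := Exec.seq (Exec.pop (O := O) S k) (Exec.pop (Function.update S k (S k).tail) k')
    have h2 := Exec.loop_cons (by simp [h]) h0 (ih _ (by simp [hk, h]))
    have ht : 1 + 1 + (3 * l.length + 1) + 1 = 3 * (c :: l).length + 1 := by simp; ring
    rw [ht] at h2
    refine Exec.of_eq h2 ?_
    funext j
    simp only [Function.update_apply, List.length_cons]
    grind [List.drop_tail]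

/-- The situation in which the command `comp e ρ d o` is executed: variables, free stacks,
query stack and target stack do not interfere, and the first are as they should be. -/
structure Ready (S : Store) (env : ℕ → List TMSymbol) (ρ : ℕ → ℕ) (d o : ℕ) : Prop where
  value : ∀ x, S (ρ x) = env x
  pos : ∀ x, 0 < ρ x
  lt : ∀ x, ρ x < d
  ne : ∀ x, ρ x ≠ o
  free : ∀ j, d ≤ j → S j = []
  query : S 0 = []
  target_pos : 0 < o
  target_lt : o < d

variable {S : Store} {env : ℕ → List TMSymbol} {ρ : ℕ → ℕ} {d o : ℕ}

/-- The target stack may be replaced by the first free one. -/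
theorem Ready.arg (h : Ready S env ρ d o) : Ready S env ρ (d + 1) d where
  value := h.value
  pos := h.pos
  lt x := (h.lt x).trans (Nat.lt_succ_self d)
  ne x := (h.lt x).ne
  free j hj := h.free j (by omega)
  query := h.query
  target_pos := h.target_pos.trans h.target_lt
  target_lt := Nat.lt_succ_self d

theorem Ready.update_target (h : Ready S env ρ d o) (l : List TMSymbol) :
    Ready (Function.update S o l) env ρ d o where
  value x := by rw [Function.update_of_ne (h.ne x), h.value]
  pos := h.pos
  lt := h.lt
  ne := h.ne
  free j hj := by
    have := h.target_lt
    rw [Function.update_of_ne (by omega), h.free j hj]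
  query := by rw [Function.update_of_ne h.target_pos.ne, h.query]
  target_pos := h.target_pos
  target_lt := h.target_lt

/-- After a value has been put on the second free stack, the remaining free stacks may be used
to compute another argument. -/
theorem Ready.arg₂ (h : Ready S env ρ d o) (l : List TMSymbol) :
    Ready (Function.update S (d + 1) l) env ρ (d + 2) d where
  value x := by
    have := h.lt x
    rw [Function.update_of_ne (by omega), h.value]
  pos := h.pos
  lt x := (h.lt x).trans (by omega)
  ne x := (h.lt x).ne
  free j hj := by rw [Function.update_of_ne (by omega), h.free j (by omega)]
  query := by rw [Function.update_of_ne (by omega), h.query]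
  target_pos := h.target_pos.trans h.target_lt
  target_lt := by omega

theorem Ready.bind (h : Ready S env ρ d o) (x : ℕ) (l : List TMSymbol) :
    Ready (Function.update S (d + 1) l) (Function.update env x l)
      (Function.update ρ x (d + 1)) (d + 2) o where
  value z := by
    have := h.lt z
    have := h.value z
    simp only [Function.update_apply]
    grind
  pos z := by
    have := h.pos z
    simp only [Function.update_apply]
    grind
  lt z := by
    have := h.lt z
    simp only [Function.update_apply]
    grind
  ne z := by
    have := h.ne z
    have := h.target_lt
    simp only [Function.update_apply]
    grind
  free j hj := by rw [Function.update_of_ne (by omega), h.free j (by omega)]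
  query := by rw [Function.update_of_ne (by omega), h.query]
  target_pos := h.target_pos
  target_lt := h.target_lt.trans (by omega)

theorem Ready.bind₂ (h : Ready S env ρ d o) (x y : ℕ) (l l' : List TMSymbol) :
    Ready (Function.update (Function.update S d l) (d + 1) l')
      (Function.update (Function.update env x l) y l')
      (Function.update (Function.update ρ x d) y (d + 1)) (d + 2) o where
  value z := by
    have := h.lt z
    have := h.value z
    simp only [Function.update_apply]
    grind
  pos z := by
    have := h.pos z
    have := h.target_lt
    simp only [Function.update_apply]
    grind
  lt z := by
    have := h.lt z
    simp only [Function.update_apply]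
    grind
  ne z := by
    have := h.ne z
    have := h.target_lt
    simp only [Function.update_apply]
    grind
  free j hj := by
    rw [Function.update_of_ne (by omega), Function.update_of_ne (by omega), h.free j (by omega)]
  query := by
    have := h.target_lt
    rw [Function.update_of_ne (by omega), Function.update_of_ne (by omega), h.query]
  target_pos := h.target_pos
  target_lt := h.target_lt.trans (by omega)

/-- The compiled form of `e` correctly evaluates `e` within the time bound. -/
def Correct (O : Set (List TMSymbol)) (e : Expr) : Prop :=
  ∀ (S : Store) (env : ℕ → List TMSymbol) (ρ : ℕ → ℕ) (d o n : ℕ), Ready S env ρ d o →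
    (∀ x, (env x).length ≤ n) → ∃ t, t ≤ e.cost.eval n ∧
      Exec O (e.comp ρ d o) S (Function.update S o ((e.eval O env).reverse ++ S o)) t

/-- Evaluation of an argument with the result in the right order. -/
theorem Correct.arg {a : Expr} (ha : Correct O a) (h : Ready S env ρ d o) {n : ℕ}
    (hn : ∀ x, (env x).length ≤ n) : ∃ t, t ≤ (a.cost + (2 * a.size + 1)).eval n ∧
      Exec O (seq (a.comp ρ (d + 1) d) (loop d (move d (d + 1)))) S
        (Function.update S (d + 1) (a.eval O env)) t := by
  obtain ⟨t, ht, he⟩ := ha S env ρ (d + 1) d n h.arg hn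
  have h0 := h.free d le_rfl
  have h1 := h.free (d + 1) (by omega)
  have h2 := Exec.seq he (exec_loop_move (k := d) (k' := d + 1) (by omega)
    ((a.eval O env).reverse) _ (by simp [h0]))
  have hl := length_eval_le O a hn
  refine ⟨_, ?_, Exec.of_eq h2 ?_⟩
  · simp only [Polynomial.eval_add, Polynomial.eval_mul, Polynomial.eval_one,
      Polynomial.eval_ofNat, List.length_reverse]
    omega
  · funext j
    simp only [Function.update_apply]
    grind

theorem correct_comp (O : Set (List TMSymbol)) (e : Expr) : Correct O e := by
  induction e with
  | nil =>
    intro S env ρ d o n h hn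
    exact ⟨1, by simp [cost], Exec.of_eq (Exec.skip S) (by simp [eval])⟩
  | sym c =>
    intro S env ρ d o n h hn
    exact ⟨1, by simp [cost], Exec.of_eq (Exec.push S o c) (by simp [eval])⟩
  | var x =>
    intro S env ρ d o n h hn
    have hx := h.value x
    have e1 := h.ne x
    have e2 := h.lt x
    have e3 := h.target_lt
    have h0 := h.free d le_rfl
    have h1 := exec_loop_dup (O := O) e1 e2.ne e3.ne (env x) S hx
    have h2 := Exec.seq h1 (exec_loop_move e2.ne' (env x).reverse _ (by simp [h0]))
    refine ⟨_, ?_, Exec.of_eq h2 ?_⟩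
    · have := hn x
      simp [cost]
      omega
    · funext j
      simp only [Function.update_apply, eval]
      grind
  | head x =>
    intro S env ρ d o n h hn
    have hx := h.value x
    have e1 := h.ne x
    have e2 := h.lt x
    have e3 := h.target_lt
    have h0 := h.free d le_rfl
    refine ⟨1 + 1, by simp [cost], ?_⟩
    cases hv : env x with
    | nil =>
      rw [hv] at hx
      exact Exec.of_eq (Exec.seq (Exec.dup_nil S _ _ _ hx) (Exec.move_nil S _ _ h0))
        (by simp [eval, hv])
    | cons c l =>
      rw [hv] at hx
      have h1 := Exec.dup_cons (O := O) S _ _ (ρ x) o d c l hx rfl rfl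
      have h2 := Exec.seq h1 (exec_move (k := d) (k' := ρ x) (c := c) (l := [])
        (by simp [h0, e2.ne', e3.ne']) e2.ne')
      refine Exec.of_eq h2 ?_
      funext j
      simp only [Function.update_apply, eval, hv]
      grind
  | hd x c =>
    intro S env ρ d o n h hn
    refine ⟨1 + 1, by simp [cost], ?_⟩
    by_cases hc : (env x).head? = some c
    · refine Exec.if_pos (by rw [h.value, hc]) (Exec.of_eq (Exec.push S o _) ?_)
      simp [eval, hc]
    · refine Exec.if_neg (by rw [h.value]; exact hc) (Exec.of_eq (Exec.skip S) ?_)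
      simp [eval, hc]
  | app a b iha ihb =>
    intro S env ρ d o n h hn
    obtain ⟨t, ht, he⟩ := iha S env ρ d o n h hn
    obtain ⟨t', ht', he'⟩ := ihb _ env ρ d o n (h.update_target _) hn
    refine ⟨t + t', ?_, Exec.of_eq (Exec.seq he he') ?_⟩
    · simp only [cost, Polynomial.eval_add]
      omega
    · simp [eval]
  | drop a b iha ihb =>
    intro S env ρ d o n h hn
    obtain ⟨t, ht, he⟩ := iha.arg h hn
    obtain ⟨t', ht', he'⟩ := ihb _ env ρ (d + 2) d n (h.arg₂ (a.eval O env)) hn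
    have h0 := h.free d le_rfl
    have h1 := h.free (d + 1) (by omega)
    have e3 := h.target_lt
    have h2 := Exec.seq he (Exec.seq he' (Exec.seq (exec_loop_pop_pop (k := d) (k' := d + 1)
      (by omega) ((b.eval O env).reverse) _ (by simp [h0]))
      (exec_loop_move (k := d + 1) (k' := o) (by omega)
        ((a.eval O env).drop (b.eval O env).length) _ (by simp))))
    have hla := length_eval_le O a hn
    have hlb := length_eval_le O b hn
    refine ⟨_, ?_, Exec.of_eq h2 ?_⟩
    · simp only [cost, Polynomial.eval_add, Polynomial.eval_mul, Polynomial.eval_one,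
        Polynomial.eval_ofNat, List.length_reverse, List.length_drop] at *
      omega
    · funext j
      simp only [Function.update_apply, eval]
      grind
  | ite a b c iha ihb ihc =>
    intro S env ρ d o n h hn
    obtain ⟨t, ht, he⟩ := iha S env ρ (d + 1) d n h.arg hn
    have h0 := h.free d le_rfl
    have hl := length_eval_le O a hn
    rw [h0, List.append_nil] at he
    by_cases hv : a.eval O env = []
    · have hS : Function.update S d (a.eval O env).reverse = S := by
        rw [hv, List.reverse_nil, ← h0, Function.update_eq_self]
      rw [hS] at he
      obtain ⟨t', ht', he'⟩ := ihc S env ρ d o n h hn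
      refine ⟨_, ?_, Exec.of_eq (Exec.seq he (Exec.if_pos (by simp [h0]) he')) ?_⟩
      · simp only [cost, Polynomial.eval_add, Polynomial.eval_one]
        omega
      · simp [eval, hv]
    · obtain ⟨t', ht', he'⟩ := ihb S env ρ d o n h hn
      have h1 := exec_loop_pop (O := O) (k := d) (a.eval O env).reverse
        (Function.update S d (a.eval O env).reverse) (by simp)
      have hS : Function.update (Function.update S d (a.eval O env).reverse) d [] = S := by
        rw [Function.update_idem, ← h0, Function.update_eq_self]
      rw [hS] at h1
      refine ⟨_, ?_, Exec.of_eq (Exec.seq he (Exec.if_neg (by simp [hv]) (Exec.seq h1 he'))) ?_⟩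
      · simp only [cost, Polynomial.eval_add, Polynomial.eval_mul, Polynomial.eval_one,
          Polynomial.eval_ofNat, List.length_reverse]
        omega
      · simp [eval, hv]
  | letE x a b iha ihb =>
    intro S env ρ d o n h hn
    obtain ⟨t, ht, he⟩ := iha.arg h hn
    have hl := length_eval_le O a hn
    obtain ⟨t', ht', he'⟩ := ihb _ _ _ (d + 2) o _ (h.bind x (a.eval O env))
      (update_length_le hn hl)
    have h1 := h.free (d + 1) (by omega)
    have e3 := h.target_lt
    have h2 := Exec.seq he (Exec.seq he' (exec_loop_pop (k := d + 1) (a.eval O env) _ (by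
      rw [Function.update_of_ne (by omega), Function.update_self])))
    refine ⟨_, ?_, Exec.of_eq h2 ?_⟩
    · simp only [cost, Polynomial.eval_add, Polynomial.eval_mul, Polynomial.eval_one,
        Polynomial.eval_ofNat, Polynomial.eval_comp, Polynomial.eval_X] at *
      omega
    · funext j
      simp only [Function.update_apply, eval]
      grind
  | zip x y a b iha ihb =>
    intro S env ρ d o n h hn
    obtain ⟨t, ht, he⟩ := iha.arg h hn
    have hl := length_eval_le O a hn
    have h0 := h.free d le_rfl
    have h1 := h.free (d + 1) (by omega)
    have e3 := h.target_lt
    have key : ∀ (l pre out : List TMSymbol), pre.length + l.length ≤ a.size.eval n →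
        ∃ t, t ≤ l.length * (b.cost.eval (n + a.size.eval n) + 2) + 1 ∧
          Exec O (loop (d + 1)
            (seq (b.comp (Function.update (Function.update ρ x d) y (d + 1)) (d + 2) o)
              (move (d + 1) d)))
            (Function.update (Function.update (Function.update S d pre) (d + 1) l) o out)
            (Function.update (Function.update (Function.update S d (l.reverse ++ pre)) (d + 1) [])
              o (((splits pre l).flatMap fun p => b.eval O
                (Function.update (Function.update env x p.1) y p.2)).reverse ++ out)) t := by
      intro l
      induction l with
      | nil =>
        intro pre out _
        refine ⟨1, by simp, Exec.of_eq (Exec.loop_nil ?_) (by simp [splits])⟩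
        rw [Function.update_of_ne (by omega), Function.update_self]
      | cons c l ih =>
        intro pre out hlen
        simp only [List.length_cons] at hlen
        obtain ⟨t₁, ht₁, he₁⟩ := ihb _ _ _ (d + 2) o _
          ((h.bind₂ x y pre (c :: l)).update_target out)
          (update₂_length_le hn (m := a.size.eval n) (by omega) (by simp; omega))
        have hb := Exec.seq he₁ (exec_move (k := d + 1) (k' := d) (c := c) (l := l) (by
          rw [Function.update_of_ne (by omega), Function.update_of_ne (by omega),
            Function.update_self]) (by omega))
        obtain ⟨t₂, ht₂, he₂⟩ := ih (c :: pre) ((b.eval O (Function.update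
          (Function.update env x pre) y (c :: l))).reverse ++ out) (by simp; omega)
        have hb := Exec.of_eq hb (S'' := Function.update (Function.update
            (Function.update S d (c :: pre)) (d + 1) l) o ((b.eval O
              (Function.update (Function.update env x pre) y (c :: l))).reverse ++ out)) (by
          funext j
          simp only [Function.update_apply]
          grind)
        have hloop := Exec.loop_cons (by
          rw [Function.update_of_ne (by omega), Function.update_self]
          simp) hb he₂
        refine ⟨_, ?_, Exec.of_eq hloop ?_⟩
        · simp only [List.length_cons, Nat.add_mul, Nat.one_mul] at *
          omega
        · funext j
          simp only [Function.update_apply, splits, List.flatMap_cons, List.reverse_append,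
            List.reverse_cons, List.append_assoc, List.singleton_append]
    obtain ⟨t', ht', he'⟩ := key (a.eval O env) [] (S o) (by simpa using hl)
    have hS : Function.update (Function.update (Function.update S d []) (d + 1) (a.eval O env)) o
        (S o) = Function.update S (d + 1) (a.eval O env) := by
      funext j
      simp only [Function.update_apply]
      grind
    rw [hS] at he'
    have h2 := Exec.seq he (Exec.seq he' (exec_loop_pop (k := d) ((a.eval O env).reverse ++ []) _
      (by rw [Function.update_of_ne (by omega), Function.update_of_ne (by omega),
        Function.update_self])))
    refine ⟨_, ?_, Exec.of_eq h2 ?_⟩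
    · have := Nat.mul_le_mul_right (b.cost.eval (n + a.size.eval n) + 2) hl
      simp only [cost, Polynomial.eval_add, Polynomial.eval_mul, Polynomial.eval_one,
        Polynomial.eval_ofNat, Polynomial.eval_comp, Polynomial.eval_X, List.length_append,
        List.length_reverse, List.length_nil] at *
      omega
    · funext j
      simp only [Function.update_apply, eval]
      grind
  | ask a iha =>
    intro S env ρ d o n h hn
    obtain ⟨t, ht, he⟩ := iha S env ρ (d + 1) d n h.arg hn
    have hl := length_eval_le O a hn
    have h0 := h.free d le_rfl
    have hq := h.query
    have e1 := h.target_pos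
    have e3 := h.target_lt
    have h2 := exec_loop_move (O := O) (k := d) (k' := 0) (by omega) (a.eval O env).reverse
      (Function.update S d ((a.eval O env).reverse ++ S d)) (by simp [h0])
    have h3 := Exec.ask (O := O) (Function.update (Function.update (Function.update S d
      ((a.eval O env).reverse ++ S d)) d []) 0 ((a.eval O env).reverse.reverse ++
        Function.update S d ((a.eval O env).reverse ++ S d) 0)) _ o rfl
    have hv : Function.update (Function.update (Function.update S d
      ((a.eval O env).reverse ++ S d)) d []) 0 ((a.eval O env).reverse.reverse ++
        Function.update S d ((a.eval O env).reverse ++ S d) 0) 0 = a.eval O env := by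
      rw [Function.update_self, Function.update_of_ne (by omega), hq]
      simp
    rw [hv] at h3
    refine ⟨_, ?_, Exec.of_eq (Exec.seq he (Exec.seq h2 h3)) ?_⟩
    · simp only [cost, Polynomial.eval_add, Polynomial.eval_mul, Polynomial.eval_one,
        Polynomial.eval_ofNat, List.length_reverse]
      omega
    · clear h2 h3 he hv hn iha
      funext j
      by_cases hO : a.eval O env ∈ O
      · simp only [hO, if_true, Function.update_apply, eval, List.reverse_singleton,
          List.singleton_append]
        grind
      · simp only [hO, if_false, Function.update_apply, eval, List.reverse_nil, List.nil_append]
        grind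

/-- A problem reduces to another one if its yes-instances are recognized by an expression that
is evaluated with the other problem as its oracle. -/
theorem polyTimeTuringReduces {A B : DecisionProblem} (e : Expr)
    (h : ∀ x, e.eval B.language (fun _ => A.encode x) ≠ [] ↔ A.Yes x) :
    PolyTimeTuringReduces A B := by
  obtain ⟨N, hN⟩ := exists_below (e.comp (fun _ => 1) 3 2)
  refine ⟨machine (N + 2) (e.comp (fun _ => 1) 3 2), e.cost + 1, fun x => ?_⟩
  have hr : Ready (Function.update (fun _ => []) 1 (A.encode x)) (fun _ => A.encode x)
      (fun _ => 1) 3 2 := by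
    refine ⟨fun _ => by simp, fun _ => by omega, fun _ => by omega, fun _ => by omega,
      fun j hj => ?_, rfl, by omega, by omega⟩
    rw [Function.update_of_ne (by omega)]
  obtain ⟨t, ht, he⟩ := correct_comp B.language e _ _ _ _ _ (A.encode x).length hr
    fun _ => le_rfl
  have := decidesWithin_machine (hN.mono (Nat.le_add_right N 2)) (by omega) he
    (T := (e.cost + 1).eval (A.encode x).length) (by simpa using ht)
  rw [← h x]
  simpa using this

end Expr

/-! ### Walks and simple paths -/

/-- `Conn R S u v`: there is a walk from `u` to `v` along the relation `R` inside the set `S`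
(the trivial walk from `u` to `u` is always allowed). -/
def Conn {α : Type*} (R : α → α → Prop) (S : Set α) : α → α → Prop :=
  Relation.ReflTransGen fun x y => R x y ∧ x ∈ S ∧ y ∈ S

theorem Conn.refl {α : Type*} {R : α → α → Prop} {S : Set α} (u : α) : Conn R S u u :=
  Relation.ReflTransGen.refl

theorem Conn.mono {α : Type*} {R : α → α → Prop} {S T : Set α} {u v : α} (h : Conn R S u v)
    (hST : S ⊆ T) : Conn R T u v :=
  Relation.ReflTransGen.mono (fun _ _ h => ⟨h.1, hST h.2.1, hST h.2.2⟩) _ _ h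

theorem exists_nodup_chain {α : Type*} {R : α → α → Prop} {u v : α}
    (h : Relation.ReflTransGen R u v) :
    ∃ l : List α, l.head? = some u ∧ l.getLast? = some v ∧ l.Nodup ∧ l.IsChain R := by
  induction h using Relation.ReflTransGen.head_induction_on with
  | refl => exact ⟨[v], by simp⟩
  | @head a b hab _ ih =>
    obtain ⟨l, h1, h2, h3, h4⟩ := ih
    by_cases ha : a ∈ l
    · obtain ⟨s, t, rfl⟩ := List.append_of_mem ha
      refine ⟨a :: t, rfl, ?_, h3.of_append_right, h4.right_of_append⟩
      rw [List.getLast?_append] at h2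
      rw [List.getLast?_eq_some_getLast (by simp : a :: t ≠ [])] at h2 ⊢
      simpa using h2
    · refine ⟨a :: l, rfl, ?_, List.nodup_cons.2 ⟨ha, h3⟩, ?_⟩
      · cases l with
        | nil => simp at h1
        | cons c l => simpa using h2
      · rw [List.isChain_cons]
        refine ⟨fun y hy => ?_, h4⟩
        rw [h1] at hy
        simp only [Option.mem_def, Option.some.injEq] at hy
        exact hy ▸ hab

theorem reflTransGen_of_chain {α : Type*} {R : α → α → Prop} {v : α} (l : List α) :
    ∀ u, l.head? = some u → l.getLast? = some v → l.IsChain R → Relation.ReflTransGen R u v := by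
  induction l with
  | nil => simp
  | cons a l ih =>
    intro u h1 h2 h3
    simp only [List.head?_cons, Option.some.injEq] at h1
    subst h1
    cases l with
    | nil =>
      simp only [List.getLast?_singleton, Option.some.injEq] at h2
      rw [h2]
    | cons b l =>
      rw [List.isChain_cons_cons] at h3
      exact Relation.ReflTransGen.head h3.1 (ih b rfl (by simpa using h2) h3.2)

theorem isChain_inside_iff {α : Type*} {R : α → α → Prop} {S : Set α} (l : List α)
    (hl : ∀ u, l.head? = some u → u ∈ S) :
    l.IsChain (fun x y => R x y ∧ x ∈ S ∧ y ∈ S) ↔ l.IsChain R ∧ ∀ c ∈ l, c ∈ S := by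
  induction l with
  | nil => simp
  | cons a l ih =>
    have ha := hl a rfl
    cases l with
    | nil => simpa using ha
    | cons b l =>
      rw [List.isChain_cons_cons, List.isChain_cons_cons]
      constructor
      · rintro ⟨⟨h1, h2, h3⟩, h4⟩
        have := (ih fun u hu => by simp at hu; exact hu ▸ h3).1 h4
        refine ⟨⟨h1, this.1⟩, ?_⟩
        intro c hc
        rcases List.mem_cons.1 hc with rfl | hc
        · exact h2
        · exact this.2 c hc
      · rintro ⟨⟨h1, h2⟩, h3⟩
        have hb := h3 b (by simp)
        exact ⟨⟨h1, ha, hb⟩, (ih fun u hu => by simp at hu; exact hu ▸ hb).2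
          ⟨h2, fun c hc => h3 c (List.mem_cons_of_mem _ hc)⟩⟩

/-! ### Schulze winners in terms of threshold graphs -/

section Schulze

variable {m : ℕ} {S : Finset (Fin m)} {V : List (Equiv.Perm (Fin m))} {a b p : Fin m}

/-- The edges of net advantage at least `w`. -/
def Strong (V : List (Equiv.Perm (Fin m))) (w : ℤ) (x y : Fin m) : Prop := w ≤ netadv V x y

theorem le_pathWeight_iff (w : ℤ) (l : List (Fin m)) :
    (w : WithTop ℤ) ≤ pathWeight V l ↔ l.IsChain (Strong V w) := by
  induction l with
  | nil => simp [pathWeight]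
  | cons a l ih =>
    cases l with
    | nil => simp [pathWeight]
    | cons b l =>
      have : pathWeight V (a :: b :: l) = min (netadv V a b : WithTop ℤ) (pathWeight V (b :: l)) :=
        rfl
      rw [this, le_min_iff, ih, List.isChain_cons_cons, WithTop.coe_le_coe]
      rfl

theorem exists_path_iff (w : ℤ) :
    (∃ l, IsElectionPath S a b l ∧ (w : WithTop ℤ) ≤ pathWeight V l) ↔
      a ∈ S ∧ Conn (Strong V w) S a b := by
  constructor
  · rintro ⟨l, ⟨h1, h2, h3, h4⟩, hw⟩
    rw [le_pathWeight_iff] at hw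
    have ha : a ∈ S := h4 a (List.mem_of_mem_head? h1)
    refine ⟨ha, reflTransGen_of_chain l a h1 h2 ((isChain_inside_iff l ?_).2 ⟨hw, h4⟩)⟩
    intro u hu
    rw [h1] at hu
    simp only [Option.some.injEq] at hu
    exact hu ▸ ha
  · rintro ⟨ha, h⟩
    obtain ⟨l, h1, h2, h3, h4⟩ := exists_nodup_chain h
    have := (isChain_inside_iff l (fun u hu => by
      rw [h1] at hu
      simp only [Option.some.injEq] at hu
      exact hu ▸ ha)).1 h4
    exact ⟨l, ⟨h1, h2, h3, this.2⟩, (le_pathWeight_iff w l).2 this.1⟩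

theorem exists_isPathStrength (ha : a ∈ S) (hb : b ∈ S) (hab : a ≠ b) :
    ∃ x, IsPathStrength S V a b x := by
  have hfin : {w | ∃ l, IsElectionPath S a b l ∧ pathWeight V l = w}.Finite := by
    refine ((List.finite_length_le (Fin m) m).image (pathWeight V)).subset ?_
    rintro w ⟨l, hl, rfl⟩
    refine ⟨l, ?_, rfl⟩
    simpa using hl.2.2.1.length_le_card
  have hne : {w | ∃ l, IsElectionPath S a b l ∧ pathWeight V l = w}.Nonempty :=
    ⟨_, [a, b], ⟨rfl, rfl, by simp [hab], by simp [ha, hb]⟩, rfl⟩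
  obtain ⟨x, hx, hmax⟩ := Set.exists_max_image _ id hfin hne
  exact ⟨x, hx, fun y hy => hmax y hy⟩

/-- The weight of a strongest path is at least `w` if and only if a walk along edges of net
advantage at least `w` exists. -/
theorem IsPathStrength.le_iff {x : WithTop ℤ} (h : IsPathStrength S V a b x) (w : ℤ) :
    (w : WithTop ℤ) ≤ x ↔ a ∈ S ∧ Conn (Strong V w) S a b := by
  rw [← exists_path_iff]
  constructor
  · intro hw
    obtain ⟨l, hl, rfl⟩ := h.1
    exact ⟨l, hl, hw⟩
  · rintro ⟨l, hl, hw⟩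
    exact hw.trans (h.2 ⟨l, hl, rfl⟩)

theorem netadv_swap (V : List (Equiv.Perm (Fin m))) (a b : Fin m) :
    netadv V a b = -netadv V b a := by
  simp [netadv]

theorem netadv_le_length (V : List (Equiv.Perm (Fin m))) (a b : Fin m) :
    netadv V a b ≤ V.length := by
  have : adv V a b ≤ V.length := List.countP_le_length
  unfold netadv
  omega

theorem netadv_le_of_isPathStrength {x : WithTop ℤ} (h : IsPathStrength S V a b x) (ha : a ∈ S)
    (hb : b ∈ S) : (netadv V a b : WithTop ℤ) ≤ x :=
  (h.le_iff _).2 ⟨ha, Relation.ReflTransGen.single ⟨le_rfl, ha, hb⟩⟩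

theorem pathWeight_ne_top (hab : a ≠ b) {l : List (Fin m)} (h : IsElectionPath S a b l) :
    ∃ w : ℤ, pathWeight V l = w ∧ w ≤ V.length := by
  obtain ⟨h1, h2, _, _⟩ := h
  rcases l with _ | ⟨c, _ | ⟨d, l⟩⟩
  · simp at h1
  · simp only [List.head?_cons, Option.some.injEq, List.getLast?_singleton] at h1 h2
    exact absurd (h1.symm.trans h2) hab
  · have hle : pathWeight V (c :: d :: l) ≤ (netadv V c d : WithTop ℤ) := min_le_left _ _
    obtain ⟨w, hw⟩ := WithTop.ne_top_iff_exists.1 (ne_top_of_le_ne_top WithTop.coe_ne_top hle)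
    refine ⟨w, hw.symm, ?_⟩
    rw [← hw, WithTop.coe_le_coe] at hle
    exact hle.trans (netadv_le_length V c d)

/-- A candidate `p` is beaten if and only if, for some positive threshold, some candidate reaches
`p` in the threshold graph but is not reached from `p`. Thresholds that are not positive are
irrelevant, since of two opposite edges one has a nonnegative weight. -/
theorem not_isSchulzeWinner_iff (hp : p ∈ S) :
    ¬ IsSchulzeWinner S V p ↔ ∃ (a : Fin m) (w : ℕ), a ≠ p ∧ 1 ≤ w ∧ w ≤ V.length ∧ a ∈ S ∧
      Conn (Strong V w) S a p ∧ ¬ Conn (Strong V w) S p a := by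
  have hw : ¬ IsSchulzeWinner S V p ↔ ∃ a ∈ S, SchulzeBeats S V a p := by
    simp [IsSchulzeWinner, hp]
  rw [hw]
  constructor
  · rintro ⟨a, ha, x, y, hx, hy, hyx⟩
    have hap : a ≠ p := by
      rintro rfl
      exact hyx.ne (hy.unique hx)
    obtain ⟨l, hl, hlx⟩ := hx.1
    obtain ⟨w, hw, hwV⟩ := pathWeight_ne_top (V := V) hap hl
    rw [hlx] at hw
    subst hw
    have h1 := netadv_le_of_isPathStrength hx ha hp
    have h2 := (netadv_le_of_isPathStrength hy hp ha).trans_lt hyx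
    rw [WithTop.coe_le_coe] at h1
    rw [WithTop.coe_lt_coe] at h2
    have h3 := netadv_swap V a p
    obtain ⟨n, rfl⟩ := Int.eq_ofNat_of_zero_le (by omega : 0 ≤ w)
    refine ⟨a, n, hap, by omega, by omega, ha, ((hx.le_iff n).1 le_rfl).2, fun h => ?_⟩
    exact hyx.not_ge ((hy.le_iff n).2 ⟨hp, h⟩)
  · rintro ⟨a, w, hap, -, -, ha, h1, h2⟩
    obtain ⟨x, hx⟩ := exists_isPathStrength (V := V) ha hp hap
    obtain ⟨y, hy⟩ := exists_isPathStrength (V := V) hp ha hap.symm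
    refine ⟨a, ha, x, y, hx, hy, ?_⟩
    refine lt_of_lt_of_le ?_ ((hx.le_iff w).2 ⟨ha, h1⟩)
    rw [← not_le, hy.le_iff]
    exact fun h => h2 h.2

end Schulze

/-! ### The layered graph for control by adding candidates -/

section Layered

variable {m : ℕ} (E : Fin m → Fin m → Prop) (C : Finset (Fin m)) (a p : Fin m) (κ : ℕ)

/-- There is a walk from `u` to `v` all of whose inner vertices are in `C`. -/
def Conflict (u v : Fin m) : Prop := Conn E ((C : Set (Fin m)) ∪ {u, v}) u v

/-- The vertex `u` may be left, using up one unit of the budget if it is not in `C`, to get from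
a state in which `i` units are used up to one with `j` units used up. -/
def Affordable (u : Fin m) (i j : ℕ) : Prop := if u ∈ C then i ≤ j else i < j

/-- The edges of the layered graph. It has two copies of each vertex in each layer; the walk from
`a` to `p` begins in the first copy (`false`) and ends in the second (`true`), and the layers
count the vertices outside `C` that it has left so far. The edges from the second copy to the
first one forbid that these parts of the walk are connected in the wrong direction. -/
def Layered : Bool × Fin m × Fin (κ + 1) → Bool × Fin m × Fin (κ + 1) → Prop
  | (false, u, i), (false, v, j) => (E u v ∧ Affordable C u i j) ∨ v = a
  | (false, u, i), (true, v, j) => E u v ∧ Affordable C u i j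
  | (true, u, _), (false, v, _) => Conflict E C u v
  | (true, u, i), (true, v, j) => (E u v ∧ Affordable C u i j) ∨ u = p

variable {E C a p κ}

/-- A cut of the layered graph yields the added candidates: those on the walk which are not in
`C`. -/
theorem exists_added_of_cut (hp : p ∈ C) {Y : Set (Bool × Fin m × Fin (κ + 1))}
    (ht : (false, a, 0) ∈ Y) (hs : (true, p, Fin.last κ) ∈ Y)
    (h : Conn (Layered E C a p κ) Y (false, a, 0) (true, p, Fin.last κ))
    (h' : ¬ Conn (Layered E C a p κ) Y (true, p, Fin.last κ) (false, a, 0)) :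
    ∃ D : Finset (Fin m), D ⊆ Cᶜ ∧ D.card ≤ κ ∧ a ∈ C ∪ D ∧
      Conn E (C ∪ D : Finset (Fin m)) a p ∧ ¬ Conn E (C ∪ D : Finset (Fin m)) p a := by
  classical
  -- otherwise the kept vertices would contain the walk `(p, κ) → u → v → (a, 0)`
  have noconf : ∀ u i v j, (true, u, i) ∈ Y → (false, v, j) ∈ Y → ¬ Conflict E C u v := by
    intro u i v j hu hv hc
    refine h' (((Relation.ReflTransGen.single (b := (true, u, i)) ⟨Or.inr rfl, hs, hu⟩).tail
      (c := (false, v, j)) ⟨hc, hu, hv⟩).tail ⟨Or.inr rfl, hv, ht⟩)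
  -- the walk followed so far, with the set `D` of those of its vertices outside `C` that have
  -- been left already
  let Inv : Fin m → ℕ → Prop := fun v j => ∃ D : Finset (Fin m), D ⊆ Cᶜ ∧ D.card ≤ j ∧
    a ∈ C ∪ insert v D ∧ Conn E (C ∪ insert v D : Finset (Fin m)) a v ∧
    ∀ d ∈ D, ∃ b i, (b, d, i) ∈ Y
  have step : ∀ u v b, ∀ i j : Fin (κ + 1), Inv u i → E u v → Affordable C u i j →
      (b, u, i) ∈ Y → Inv v j := by
    rintro u v b i j ⟨D, h1, h2, h3, h4, h5⟩ huv hij hu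
    have hsub : C ∪ insert u D ⊆ C ∪ insert v (D ∪ ({u} \ C)) := by
      intro x hx
      simp only [Finset.mem_union, Finset.mem_insert, Finset.mem_sdiff,
        Finset.mem_singleton] at *
      tauto
    refine ⟨D ∪ ({u} \ C), ?_, ?_, hsub h3, ?_, ?_⟩
    · intro x hx
      simp only [Finset.mem_union, Finset.mem_sdiff, Finset.mem_compl] at *
      rcases hx with hx | hx
      · exact Finset.mem_compl.1 (h1 hx)
      · exact hx.2
    · unfold Affordable at hij
      have := Finset.card_union_le D ({u} \ C)
      by_cases hC : u ∈ C
      · simp only [hC, if_true] at hij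
        have hsd : ({u} \ C : Finset (Fin m)) = ∅ := by simp [hC]
        rw [hsd, Finset.card_empty] at this
        rw [hsd]
        omega
      · simp only [hC, if_false] at hij
        have : ({u} \ C : Finset (Fin m)).card ≤ 1 :=
          (Finset.card_le_card Finset.sdiff_subset).trans_eq (Finset.card_singleton u)
        omega
    · refine (h4.mono (Finset.coe_subset.2 hsub)).tail ⟨huv, hsub (by simp), by simp⟩
    · intro d hd
      simp only [Finset.mem_union, Finset.mem_sdiff, Finset.mem_singleton] at hd
      rcases hd with hd | ⟨rfl, -⟩
      · exact h5 d hd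
      · exact ⟨_, _, hu⟩
  -- edges into copies of `a` restart the walk, edges out of copies of `p` end it
  have walk : Inv p κ := by
    have key : ∀ z, Conn (Layered E C a p κ) Y (false, a, 0) z → Inv p κ ∨ Inv z.2.1 z.2.2 := by
      intro z hz
      induction hz with
      | refl =>
        exact Or.inr ⟨∅, by simp, by simp, by simp, Relation.ReflTransGen.refl, by simp⟩
      | @tail y z _ hyz ih =>
        rcases ih with ih | ih
        · exact Or.inl ih
        · obtain ⟨b, u, i⟩ := y
          obtain ⟨b', v, j⟩ := z
          obtain ⟨hyz, hy, hz⟩ := hyz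
          rcases b with _ | _ <;> rcases b' with _ | _
          · rcases hyz with hyz | rfl
            · exact Or.inr (step u v _ i j ih hyz.1 hyz.2 hy)
            · exact Or.inr ⟨∅, by simp, by simp, by simp, Relation.ReflTransGen.refl, by simp⟩
          · exact Or.inr (step u v _ i j ih hyz.1 hyz.2 hy)
          · exact absurd hyz (noconf u i v j hy hz)
          · rcases hyz with hyz | rfl
            · exact Or.inr (step u v _ i j ih hyz.1 hyz.2 hy)
            · obtain ⟨D, h1, h2, h3⟩ := ih
              exact Or.inl ⟨D, h1, h2.trans (Nat.lt_succ_iff.1 i.2), h3⟩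
    rcases key _ h with h | h
    · exact h
    · exact h
  obtain ⟨D, h1, h2, h3, h4, h5⟩ := walk
  have hD : C ∪ insert p D = C ∪ D := by
    ext x
    simp only [Finset.mem_union, Finset.mem_insert]
    constructor
    · rintro (h | rfl | h)
      exacts [Or.inl h, Or.inl hp, Or.inr h]
    · rintro (h | h)
      exacts [Or.inl h, Or.inr (Or.inr h)]
  rw [hD] at h3 h4
  refine ⟨D, h1, h2, h3, h4, fun hpa => ?_⟩
  -- a walk from `p` is followed from the last added candidate on it, which is kept in its second
  -- copy because no earlier such candidate conflicts with a first copy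
  have key : ∀ z, Conn E (C ∪ D : Finset (Fin m)) p z →
      ∃ x i, (true, x, i) ∈ Y ∧ Conflict E C x z := by
    intro z hz
    induction hz with
    | refl => exact ⟨p, _, hs, Relation.ReflTransGen.refl⟩
    | @tail y z _ hyz ih =>
      obtain ⟨x, i, hx, hc⟩ := ih
      obtain ⟨hE, hy, -⟩ := hyz
      rcases Finset.mem_union.1 (Finset.mem_coe.1 hy) with hyC | hyD
      · refine ⟨x, i, hx, Relation.ReflTransGen.tail (hc.mono ?_) ⟨hE, Or.inl hyC, by simp⟩⟩
        rintro v (hv | rfl | rfl)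
        · exact Or.inl hv
        · simp
        · exact Or.inl hyC
      · obtain ⟨b, j, hj⟩ := h5 y hyD
        cases b with
        | false => exact absurd hc (noconf x i y j hx hj)
        | true => exact ⟨y, j, hj, Relation.ReflTransGen.single ⟨hE, by simp, by simp⟩⟩
  obtain ⟨x, i, hx, hc⟩ := key a hpa
  exact noconf x i a 0 hx ht hc

/-- Added candidates yield a cut of the layered graph: keep a vertex in its second copy if it is
reachable from `p`, and in its first copy otherwise. The walk from `a` to `p` survives since it
never returns from the second copies to the first ones. -/
theorem exists_cut_of_added (hp : p ∈ C) {D : Finset (Fin m)} (hD : D.card ≤ κ) (ha : a ∈ C ∪ D)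
    (h : Conn E (C ∪ D : Finset (Fin m)) a p) (h' : ¬ Conn E (C ∪ D : Finset (Fin m)) p a) :
    ∃ Y : Set (Bool × Fin m × Fin (κ + 1)), (false, a, 0) ∈ Y ∧ (true, p, Fin.last κ) ∈ Y ∧
      Conn (Layered E C a p κ) Y (false, a, 0) (true, p, Fin.last κ) ∧
      ¬ Conn (Layered E C a p κ) Y (true, p, Fin.last κ) (false, a, 0) := by
  classical
  set S : Finset (Fin m) := C ∪ D with hS
  let Y : Set (Bool × Fin m × Fin (κ + 1)) :=
    {z | z.2.1 ∈ S ∧ (z.1 = true ↔ Conn E S p z.2.1)}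
  have hpS : p ∈ S := Finset.mem_union_left _ hp
  refine ⟨Y, ⟨ha, by simpa using h'⟩, ⟨hpS, by simpa using Conn.refl _⟩, ?_, ?_⟩
  -- the walk is lifted to the layered graph by putting each vertex into its kept copy, in the layer
  -- given by the number of vertices outside `C` before it
  · have lift : ∀ (l : List (Fin m)) (u : Fin m) (b : Bool) (i : ℕ) (hi : i < κ + 1),
        l.head? = some u → l.getLast? = some p →
        l.IsChain (fun x y => E x y ∧ x ∈ (S : Set (Fin m)) ∧ y ∈ (S : Set (Fin m))) →
        i + (l.filter (· ∉ C)).length ≤ κ → (b, u, (⟨i, hi⟩ : Fin (κ + 1))) ∈ Y →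
        Conn (Layered E C a p κ) Y (b, u, ⟨i, hi⟩) (true, p, Fin.last κ) := by
      intro l
      induction l with
      | nil => simp
      | cons c l ih =>
        intro u b i hi hu hlast hl hlen hY
        simp only [List.head?_cons, Option.some.injEq] at hu
        subst hu
        cases l with
        | nil =>
          simp only [List.getLast?_singleton, Option.some.injEq] at hlast
          subst hlast
          have hb : b = true := hY.2.2 Relation.ReflTransGen.refl
          subst hb
          exact Relation.ReflTransGen.single
            ⟨Or.inr rfl, hY, hpS, by simpa using Conn.refl _⟩
        | cons v l =>
          rw [List.isChain_cons_cons] at hl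
          obtain ⟨⟨hE, hc, hv⟩, hl⟩ := hl
          set j : ℕ := if c ∈ C then i else i + 1 with hj
          have hlen' : j + ((v :: l).filter (· ∉ C)).length ≤ κ := by
            by_cases hcC : c ∈ C <;> simp [hcC, hj] at hlen ⊢ <;> omega
          have haff : Affordable C c i j := by
            unfold Affordable
            by_cases hcC : c ∈ C <;> simp [hcC, hj]
          have hjκ : j < κ + 1 := by omega
          have hvY : (decide (Conn E S p v), v, (⟨j, hjκ⟩ : Fin (κ + 1))) ∈ Y := ⟨hv, by simp⟩
          have hnext := ih v (decide (Conn E S p v)) j hjκ rfl (by simpa using hlast) hl hlen' hvY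
          refine Relation.ReflTransGen.head ⟨?_, hY, hvY⟩ hnext
          cases b with
          | false =>
            cases hdec : decide (Conn E S p v) with
            | false => exact Or.inl ⟨hE, haff⟩
            | true => exact ⟨hE, haff⟩
          | true =>
            have hpc : Conn E S p c := hY.2.1 rfl
            have hpv : Conn E S p v := hpc.tail ⟨hE, hc, hv⟩
            rw [decide_eq_true hpv]
            exact Or.inl ⟨hE, haff⟩
    obtain ⟨l, h1, h2, h3, h4⟩ := exists_nodup_chain h
    have hmem := ((isChain_inside_iff l (fun u hu => by
      rw [h1] at hu
      simp only [Option.some.injEq] at hu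
      exact hu ▸ ha)).1 h4).2
    refine lift l a false 0 (Nat.succ_pos κ) h1 h2 h4 ?_ ⟨ha, by simpa using h'⟩
    rw [Nat.zero_add, ← List.toFinset_card_of_nodup (h3.filter _)]
    refine (Finset.card_le_card fun x hx => ?_).trans hD
    simp only [List.mem_toFinset, List.mem_filter, decide_eq_true_eq] at hx
    exact (Finset.mem_union.1 (hmem x hx.1)).resolve_left hx.2
  · intro hc
    have key : ∀ z, Conn (Layered E C a p κ) Y (true, p, Fin.last κ) z → z.1 = true := by
      intro z hz
      induction hz with
      | refl => rfl
      | @tail y z _ hyz ih =>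
        obtain ⟨b, u, i⟩ := y
        obtain ⟨b', v, j⟩ := z
        obtain ⟨hyz, hy, hz⟩ := hyz
        simp only at ih
        subst ih
        cases b' with
        | true => rfl
        | false =>
          have hpu : Conn E S p u := hy.2.1 rfl
          have huv : Conn E S u v := Conn.mono hyz (by
            rintro x (hx | rfl | rfl)
            · exact Finset.mem_coe.2 (Finset.mem_union_left _ hx)
            · exact hy.1
            · exact hz.1)
          exact hz.2.2 (hpu.trans huv)
    simpa using key _ hc

end Layered

namespace Expr

/-! ### Truth values of expressions -/

/-- The value of `e`, read as a truth value, is true. -/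
def Holds (O : Set (List TMSymbol)) (e : Expr) (env : ℕ → List TMSymbol) : Prop :=
  e.eval O env ≠ []

/-- Conjunction. -/
def and (a b : Expr) : Expr := ite a b nil

/-- Negation. -/
def not (a : Expr) : Expr := ite a nil (sym (Γ'.bit true))

/-- The values of `a` and `b` have equal lengths. -/
def eqLen (a b : Expr) : Expr := not (app (drop a b) (drop b a))

/-- A bit that gives the truth value of `a`. -/
def bitE (a : Expr) : Expr := ite a (sym (Γ'.bit true)) (sym (Γ'.bit false))

variable {O : Set (List TMSymbol)} {env : ℕ → List TMSymbol} {a b c : Expr}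

theorem eval_nil : nil.eval O env = [] := rfl

theorem eval_sym {c : TMSymbol} : (sym c).eval O env = [c] := rfl

theorem eval_var {x : ℕ} : (var x).eval O env = env x := rfl

theorem eval_app : (app a b).eval O env = a.eval O env ++ b.eval O env := rfl

theorem eval_drop : (drop a b).eval O env = (a.eval O env).drop (b.eval O env).length := rfl

theorem eval_letE {x : ℕ} :
    (letE x a b).eval O env = b.eval O (Function.update env x (a.eval O env)) := rfl

theorem eval_zip {x y : ℕ} : (zip x y a b).eval O env =
    (splits [] (a.eval O env)).flatMap fun p =>
      b.eval O (Function.update (Function.update env x p.1) y p.2) := rfl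

open Classical in
theorem eval_ite :
    (ite a b c).eval O env = if a.Holds O env then b.eval O env else c.eval O env := by
  unfold Holds
  by_cases h : a.eval O env = [] <;> simp [eval, h]

theorem holds_nil : nil.Holds O env ↔ False := by simp [Holds, eval]

theorem holds_sym {c : TMSymbol} : (sym c).Holds O env ↔ True := by simp [Holds, eval]

theorem holds_var {x : ℕ} : (var x).Holds O env ↔ env x ≠ [] := Iff.rfl

theorem holds_hd {x : ℕ} {c : TMSymbol} : (hd x c).Holds O env ↔ (env x).head? = some c := by
  simp [Holds, eval]

theorem holds_app : (app a b).Holds O env ↔ a.Holds O env ∨ b.Holds O env := by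
  simp only [Holds, eval, ne_eq, List.append_eq_nil_iff]
  tauto

theorem holds_drop :
    (drop a b).Holds O env ↔ (b.eval O env).length < (a.eval O env).length := by
  simp [Holds, eval]

theorem holds_ite : (ite a b c).Holds O env ↔
    (a.Holds O env ∧ b.Holds O env) ∨ (¬ a.Holds O env ∧ c.Holds O env) := by
  unfold Holds
  by_cases h : a.eval O env = [] <;> simp [eval, h]

theorem holds_letE {x : ℕ} :
    (letE x a b).Holds O env ↔ b.Holds O (Function.update env x (a.eval O env)) := Iff.rfl

theorem holds_zip {x y : ℕ} : (zip x y a b).Holds O env ↔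
    ∃ p ∈ splits [] (a.eval O env),
      b.Holds O (Function.update (Function.update env x p.1) y p.2) := by
  simp [Holds, eval]

theorem holds_ask : (ask a).Holds O env ↔ a.eval O env ∈ O := by
  simp [Holds, eval]

theorem holds_and : (and a b).Holds O env ↔ a.Holds O env ∧ b.Holds O env := by
  simp [and, holds_ite, holds_nil]

theorem holds_not : (not a).Holds O env ↔ ¬ a.Holds O env := by
  simp [not, holds_ite, holds_nil, holds_sym]

theorem holds_eqLen :
    (eqLen a b).Holds O env ↔ (a.eval O env).length = (b.eval O env).length := by
  simp only [eqLen, holds_not, holds_app, holds_drop]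
  omega

open Classical in
theorem eval_bitE : (bitE a).eval O env = [Γ'.bit (decide (a.Holds O env))] := by
  unfold bitE
  rw [eval_ite]
  split <;> simp_all [eval]

/-! ### Unary numbers, loops over them, and initial segments -/

/-- A natural number in unary. -/
def ones (n : ℕ) : List TMSymbol := List.replicate n (Γ'.bit true)

@[simp] theorem length_ones (n : ℕ) : (ones n).length = n := List.length_replicate

theorem ones_add (m n : ℕ) : ones m ++ ones n = ones (m + n) := List.replicate_append_replicate

theorem drop_ones (m n : ℕ) : (ones m).drop n = ones (m - n) := List.drop_replicate

theorem ones_one : [Γ'.bit true] = ones 1 := rfl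

theorem encUnary_eq (n : ℕ) : encUnary n = ones n ++ [Γ'.comma] := rfl

theorem splits_ones (m n : ℕ) :
    splits (ones m) (ones n) = (List.range n).map fun i => (ones (m + i), ones (n - i)) := by
  induction n generalizing m with
  | zero => rfl
  | succ n ih =>
    have h1 : ones (n + 1) = Γ'.bit true :: ones n := rfl
    have h2 : Γ'.bit true :: ones m = ones (m + 1) := rfl
    rw [List.range_succ_eq_map, List.map_cons, List.map_map, h1]
    simp only [splits]
    rw [h2, ih]
    simp only [h1, Nat.add_zero, Nat.sub_zero, List.cons.injEq, true_and]
    refine List.map_congr_left fun i _ => ?_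
    simp only [Function.comp, Nat.succ_eq_add_one, Prod.mk.injEq]
    exact ⟨by congr 1; omega, by congr 1; omega⟩

/-- A loop over the numbers `0, …, n - 1`, where the value of `a` is `n` in unary. The rest of this
value, bound to the variable `99`, is not used. -/
def forU (x : ℕ) (a b : Expr) : Expr := zip x 99 a b

theorem eval_forU {x n : ℕ} (h : a.eval O env = ones n) :
    (forU x a b).eval O env = (List.finRange n).flatMap fun i : Fin n =>
      b.eval O (Function.update (Function.update env x (ones i)) 99 (ones (n - i))) := by
  have h0 : splits [] (ones n) = (List.range n).map fun i => (ones i, ones (n - i)) := by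
    have := splits_ones 0 n
    simp only [Nat.zero_add] at this
    exact this
  unfold forU
  rw [eval_zip, h, h0, ← List.map_coe_finRange_eq_range, List.map_map, List.flatMap_map]
  rfl

theorem eval_forU_const {x n k : ℕ} (h : a.eval O env = ones n) (hb : ∀ l l',
      b.eval O (Function.update (Function.update env x l) 99 l') = ones k) :
    (forU x a b).eval O env = ones (n * k) := by
  rw [eval_forU h]
  simp only [hb]
  have : ∀ l : List (Fin n), l.flatMap (fun _ => ones k) = ones (l.length * k) := by
    intro l
    induction l with
    | nil => simp [ones]
    | cons c l ih =>
      rw [List.flatMap_cons, ih, ones_add, List.length_cons]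
      congr 1
      ring
  rw [this, List.length_finRange]

theorem holds_forU {x n : ℕ} (h : a.eval O env = ones n) :
    (forU x a b).Holds O env ↔ ∃ i : Fin n,
      b.Holds O (Function.update (Function.update env x (ones i)) 99 (ones (n - i))) := by
  simp [Holds, eval_forU h]

/-- The positions at which the symbol `c` occurs in the value of `a`. -/
def occ (c : TMSymbol) (a : Expr) : Expr := zip 102 103 a (hd 103 c)

theorem eval_occ {c : TMSymbol} : (occ c a).eval O env = ones ((a.eval O env).count c) := by
  unfold occ
  rw [eval_zip]
  generalize a.eval O env = l
  have : ∀ acc, ((splits acc l).flatMap fun p => (hd 103 c).eval O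
      (Function.update (Function.update env 102 p.1) 103 p.2)) = ones (l.count c) := by
    induction l with
    | nil => intro acc; rfl
    | cons d l ih =>
      intro acc
      simp only [splits, List.flatMap_cons, ih]
      by_cases h : d = c
      · simp [eval, h, ones_one, ones_add, Nat.add_comm]
      · simp [eval, h]
  exact this []

theorem holds_occ {c : TMSymbol} : (occ c a).Holds O env ↔ c ∈ a.eval O env := by
  unfold Holds
  rw [eval_occ, ← List.count_pos_iff, ← List.length_pos_iff, length_ones]

/-- The part of the value of `a` before the first occurrence of the symbol `c`. -/
def takeTo (c : TMSymbol) (a : Expr) : Expr :=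
  zip 100 101 a (ite (app (occ c (var 100)) (hd 101 c)) nil (head 101))

theorem eval_takeTo {c : TMSymbol} :
    (takeTo c a).eval O env = (a.eval O env).takeWhile (· ≠ c) := by
  classical
  unfold takeTo
  rw [eval_zip]
  generalize a.eval O env = l
  have key : ∀ (p : List TMSymbol × List TMSymbol),
      (ite (app (occ c (var 100)) (hd 101 c)) nil (head 101)).eval O
        (Function.update (Function.update env 100 p.1) 101 p.2) =
      if c ∈ p.1 ∨ p.2.head? = some c then [] else p.2.take 1 := by
    intro p
    rw [eval_ite]
    simp [holds_app, holds_occ, holds_hd, eval]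
  simp only [key]
  have h1 : ∀ (l acc : List TMSymbol), c ∈ acc → ((splits acc l).flatMap fun p =>
      if c ∈ p.1 ∨ p.2.head? = some c then [] else p.2.take 1) = [] := by
    intro l
    induction l with
    | nil => intro acc _; rfl
    | cons d l ih =>
      intro acc hacc
      simp [splits, hacc, ih (d :: acc) (List.mem_cons_of_mem _ hacc)]
  have h2 : ∀ (l acc : List TMSymbol), c ∉ acc → ((splits acc l).flatMap fun p =>
      if c ∈ p.1 ∨ p.2.head? = some c then [] else p.2.take 1) = l.takeWhile (· ≠ c) := by
    intro l
    induction l with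
    | nil => intro acc _; rfl
    | cons d l ih =>
      intro acc hacc
      simp only [splits, List.flatMap_cons]
      by_cases h : d = c
      · subst h
        rw [h1 l (d :: acc) (by simp)]
        simp
      · rw [ih (d :: acc) (by simp [hacc, Ne.symm h])]
        simp [hacc, h]
  exact h2 l [] (by simp)

theorem takeWhile_ne_append {c : TMSymbol} {l r : List TMSymbol} (h : c ∉ l) :
    (l ++ c :: r).takeWhile (· ≠ c) = l := by
  rw [List.takeWhile_append_of_pos]
  · simp
  · intro d hd
    simp only [ne_eq, decide_not, Bool.not_eq_eq_eq_not, Bool.not_true, decide_eq_false_iff_not]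
    rintro rfl
    exact h hd

/-! ### Scanning lists of terminated strings -/

/-- The nonempty suffixes of a list. -/
def sufs {α : Type*} : List α → List (List α)
  | [] => []
  | c :: l => (c :: l) :: sufs l

theorem mem_sufs {α : Type*} {s l : List α} : s ∈ sufs l ↔ ∃ i, i < l.length ∧ s = l.drop i := by
  induction l with
  | nil => simp [sufs]
  | cons c l ih =>
    simp only [sufs, List.mem_cons, ih]
    constructor
    · rintro (rfl | ⟨i, hi, rfl⟩)
      · exact ⟨0, by simp, rfl⟩
      · exact ⟨i + 1, by simpa using hi, rfl⟩
    · rintro ⟨i, hi, rfl⟩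
      cases i with
      | zero => exact Or.inl rfl
      | succ i => exact Or.inr ⟨i, by simpa using hi, rfl⟩

/-- A loop over those positions in the value of `a` where a string begins, if this value is a
list of strings each of which is terminated by the symbol `c`. -/
def scan (c : TMSymbol) (x y : ℕ) (a b : Expr) : Expr :=
  zip x y a (ite (app (hd x c) (not (var x))) b nil)

theorem eval_scan {α : Type*} {c : TMSymbol} {x y : ℕ} {f : α → List TMSymbol}
    (hf : ∀ t, c ∉ f t) (hxy : x ≠ y) {ts : List α}
    (ha : a.eval O env = ts.flatMap fun t => f t ++ [c]) {g : List α → List TMSymbol}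
    (hb : ∀ l, ∀ s ∈ sufs ts,
      b.eval O (Function.update (Function.update env x l) y (s.flatMap fun t => f t ++ [c])) =
        g s) :
    (scan c x y a b).eval O env = (sufs ts).flatMap g := by
  classical
  have key : ∀ p : List TMSymbol × List TMSymbol,
      (ite (app (hd x c) (not (var x))) b nil).eval O
        (Function.update (Function.update env x p.1) y p.2) =
      if p.1.head? = some c ∨ p.1 = [] then
        b.eval O (Function.update (Function.update env x p.1) y p.2) else [] := by
    intro p
    rw [eval_ite]
    simp [holds_app, holds_hd, holds_not, holds_var, Function.update_of_ne hxy, eval_nil]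
  unfold scan
  rw [eval_zip, ha]
  simp only [key]
  have skip : ∀ (t r acc : List TMSymbol), c ∉ t → acc.head? ≠ some c → acc ≠ [] →
      ((splits acc (t ++ c :: r)).flatMap fun p =>
        if p.1.head? = some c ∨ p.1 = [] then
          b.eval O (Function.update (Function.update env x p.1) y p.2) else []) =
      ((splits (c :: (t.reverse ++ acc)) r).flatMap fun p =>
        if p.1.head? = some c ∨ p.1 = [] then
          b.eval O (Function.update (Function.update env x p.1) y p.2) else []) := by
    intro t
    induction t with
    | nil =>
      intro r acc _ h1 h2
      simp [splits, h1, h2]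
    | cons d t ih =>
      intro r acc h h1 h2
      simp only [List.mem_cons, not_or] at h
      have := ih r (d :: acc) h.2 (by simpa using Ne.symm h.1) (by simp)
      simp only [List.cons_append, splits, List.flatMap_cons, this]
      simp [h1, h2]
  have main : ∀ (s : List α), (∀ s' ∈ sufs s, s' ∈ sufs ts) → ∀ acc : List TMSymbol,
      (acc.head? = some c ∨ acc = []) →
      ((splits acc (s.flatMap fun t => f t ++ [c])).flatMap fun p =>
        if p.1.head? = some c ∨ p.1 = [] then
          b.eval O (Function.update (Function.update env x p.1) y p.2) else []) =
      (sufs s).flatMap g := by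
    intro s
    induction s with
    | nil => intro _ acc _; rfl
    | cons t s ih =>
      intro hs acc hacc
      have hb' := hb acc (t :: s) (hs _ (by simp [sufs]))
      have ih' := ih fun s' hs' => hs s' (by simp [sufs, hs'])
      simp only [sufs, List.flatMap_cons]
      rw [← hb']
      simp only [List.flatMap_cons, List.append_assoc, List.singleton_append]
      have hft := hf t
      cases hcase : f t with
      | nil =>
        simp only [List.nil_append, splits, List.flatMap_cons, hacc, if_true]
        rw [ih' (c :: acc) (by simp)]
      | cons d u =>
        rw [hcase] at hft
        simp only [List.mem_cons, not_or] at hft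
        simp only [List.cons_append, splits, List.flatMap_cons, hacc, if_true]
        rw [skip u _ (d :: acc) hft.2 (by simpa using Ne.symm hft.1) (by simp), ih' _ (by simp)]
  exact main ts (fun _ h => h) [] (Or.inr rfl)

/-! ### Net advantages -/

/-- The vote given by the variable `32` lists the candidate `x` not after the candidate `y`. -/
def notAfter (x y : ℕ) : Expr :=
  scan Γ'.comma 33 34 (var 32) (and (eqLen (takeTo Γ'.comma (var 34)) (var x))
    (scan Γ'.comma 35 36 (var 34) (eqLen (takeTo Γ'.comma (var 36)) (var y))))

/-- The number of the votes given by the variable `5` that list `x` not after `y`. -/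
def countVotes (x y : ℕ) : Expr :=
  scan Γ'.ket 30 31 (var 5)
    (letE 32 (takeTo Γ'.ket (var 31)) (ite (notAfter x y) (sym (Γ'.bit true)) nil))

/-- The net advantage of `x` over `y` is at least the value of the variable `7`. -/
def edge (x y : ℕ) : Expr :=
  drop (app (countVotes x y) (sym (Γ'.bit true))) (app (countVotes y x) (var 7))

theorem comma_notMem_ones (n : ℕ) : Γ'.comma ∉ ones n := by simp [ones]

open Classical in
theorem eval_not : (not a).eval O env = if a.Holds O env then [] else [Γ'.bit true] := by
  unfold not
  rw [eval_ite, eval_nil, eval_sym]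

open Classical in
theorem eval_and : (and a b).eval O env = if a.Holds O env then b.eval O env else [] := by
  unfold and
  rw [eval_ite, eval_nil]

open Classical in
/-- Testing whether a list of unary numbers begins with a given number. -/
theorem eval_eqLen_takeTo {m : ℕ} {y z : ℕ} {i : Fin m} (hz : env z = ones i)
    {s : List (Fin m)} (hs : s ≠ []) (hy : env y = s.flatMap fun i : Fin m => encUnary i) :
    (eqLen (takeTo Γ'.comma (var y)) (var z)).eval O env =
      if s.head? = some i then [Γ'.bit true] else [] := by
  obtain ⟨c, s, rfl⟩ := List.exists_cons_of_ne_nil hs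
  unfold eqLen
  rw [eval_not]
  simp only [holds_app, holds_drop, eval_takeTo, eval_var, hy, hz, List.flatMap_cons, encUnary_eq,
    List.append_assoc, List.singleton_append, List.head?_cons, Option.some.injEq, Fin.ext_iff]
  rw [takeWhile_ne_append (comma_notMem_ones _)]
  simp only [length_ones]
  by_cases h : (c : ℕ) = i
  · simp [h]
  · rw [if_pos (by omega), if_neg h]

open Classical in
theorem eval_scan_unary {m x y z : ℕ} {i : Fin m} (hxy : x ≠ y) (hzx : z ≠ x) (hzy : z ≠ y)
    (hz : env z = ones i) {cs : List (Fin m)}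
    (ha : a.eval O env = cs.flatMap fun i : Fin m => encUnary i) :
    (scan Γ'.comma x y a (eqLen (takeTo Γ'.comma (var y)) (var z))).eval O env =
      (sufs cs).flatMap fun s => if s.head? = some i then [Γ'.bit true] else [] := by
  refine eval_scan (f := fun i : Fin m => ones i) (fun t => comma_notMem_ones t) hxy ha ?_
  intro l s hs
  refine eval_eqLen_takeTo (by simp [Function.update_of_ne, hzx, hzy, hz]) ?_
    (by rw [Function.update_self]; rfl)
  obtain ⟨j, hj, rfl⟩ := mem_sufs.1 hs
  simpa using hj

theorem holds_notAfter {m x y : ℕ} {i j : Fin m} (hx : env x = ones i) (hy : env y = ones j)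
    (hxb : x < 30) (hyb : y < 30) {cs : List (Fin m)}
    (h : env 32 = cs.flatMap fun i : Fin m => encUnary i) :
    (notAfter x y).Holds O env ↔
      ∃ s ∈ sufs cs, s.head? = some i ∧ ∃ s' ∈ sufs s, s'.head? = some j := by
  classical
  have h1 := eval_scan (O := O) (env := env) (a := var 32)
    (b := and (eqLen (takeTo Γ'.comma (var 34)) (var x))
      (scan Γ'.comma 35 36 (var 34) (eqLen (takeTo Γ'.comma (var 36)) (var y))))
    (f := fun i : Fin m => ones i) (fun t => comma_notMem_ones t) (by decide : 33 ≠ 34) h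
    (g := fun s => if s.head? = some i then
      (sufs s).flatMap fun s => if s.head? = some j then [Γ'.bit true] else [] else []) (by
      intro l s hs
      have hs' : s ≠ [] := by
        obtain ⟨j, hj, rfl⟩ := mem_sufs.1 hs
        simpa using hj
      rw [eval_and, eval_scan_unary (m := m) (i := j) (cs := s) (by omega) (by omega) (by omega)
        (by rw [Function.update_of_ne (by omega), Function.update_of_ne (by omega), hy])
        (by rw [eval_var, Function.update_self]; rfl)]
      unfold Holds
      rw [eval_eqLen_takeTo (m := m) (i := i) (s := s)
        (by rw [Function.update_of_ne (by omega), Function.update_of_ne (by omega), hx])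
        hs' (by rw [Function.update_self]; rfl)]
      by_cases hi : s.head? = some i <;> simp [hi])
  unfold Holds notAfter
  rw [h1]
  simp

theorem exists_sufs_iff {m : ℕ} (v : Equiv.Perm (Fin m)) (i j : Fin m) :
    (∃ s ∈ sufs (List.ofFn v), s.head? = some i ∧ ∃ s' ∈ sufs s, s'.head? = some j) ↔
      v.symm i ≤ v.symm j := by
  constructor
  · rintro ⟨s, hs, hi, s', hs', hj⟩
    obtain ⟨k, hk, rfl⟩ := mem_sufs.1 hs
    obtain ⟨l, hl, rfl⟩ := mem_sufs.1 hs'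
    rw [List.drop_drop] at hj
    rw [List.head?_drop, List.getElem?_eq_some_iff] at hi hj
    obtain ⟨h1, h2⟩ := hi
    obtain ⟨h3, h4⟩ := hj
    rw [List.getElem_ofFn] at h2 h4
    rw [← h2, ← h4, Equiv.symm_apply_apply, Equiv.symm_apply_apply, Fin.mk_le_mk]
    omega
  · intro h
    refine ⟨(List.ofFn v).drop (v.symm i), mem_sufs.2 ⟨_, by simp, rfl⟩, ?_,
      ((List.ofFn v).drop (v.symm i)).drop (v.symm j - v.symm i), mem_sufs.2 ⟨_, ?_, rfl⟩, ?_⟩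
    · rw [List.head?_drop, List.getElem?_eq_some_iff]
      exact ⟨by simp, by simp⟩
    · have := (v.symm j).2
      have : (v.symm i : ℕ) ≤ v.symm j := h
      simp only [List.length_drop, List.length_ofFn]
      omega
    · have h' : (v.symm i : ℕ) ≤ v.symm j := h
      rw [List.drop_drop, List.head?_drop, List.getElem?_eq_some_iff]
      exact ⟨by simp [Nat.add_sub_cancel' h'], by simp [Nat.add_sub_cancel' h']⟩

theorem eval_countVotes {m x y : ℕ} {i j : Fin m} (hx : env x = ones i) (hy : env y = ones j)
    (hxb : x < 30) (hyb : y < 30) {V : List (Equiv.Perm (Fin m))} (hV : env 5 = encVotes V) :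
    (countVotes x y).eval O env = ones (V.countP fun v => decide (v.symm i ≤ v.symm j)) := by
  classical
  have hket : ∀ v : Equiv.Perm (Fin m),
      Γ'.ket ∉ (List.ofFn v).flatMap fun i : Fin m => encUnary i := by
    intro v
    simp [encUnary]
  have h1 := eval_scan (O := O) (env := env) (a := var 5)
    (b := letE 32 (takeTo Γ'.ket (var 31)) (ite (notAfter x y) (sym (Γ'.bit true)) nil))
    (f := fun v : Equiv.Perm (Fin m) => (List.ofFn v).flatMap fun i : Fin m => encUnary i)
    hket (by decide : 30 ≠ 31) hV
    (g := fun s => match s.head? with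
      | none => []
      | some v => if v.symm i ≤ v.symm j then [Γ'.bit true] else []) (by
      intro l s hs
      obtain ⟨k, hk, rfl⟩ := mem_sufs.1 hs
      rw [List.drop_eq_getElem_cons hk]
      generalize V[k] = v
      rw [eval_letE, eval_takeTo, eval_var, Function.update_self]
      simp only [List.flatMap_cons, List.append_assoc, List.singleton_append]
      rw [takeWhile_ne_append (hket v), eval_ite, holds_notAfter (m := m) (i := i) (j := j)
        (cs := List.ofFn v)
        (by rw [Function.update_of_ne (by omega), Function.update_of_ne (by omega),
          Function.update_of_ne (by omega), hx])
        (by rw [Function.update_of_ne (by omega), Function.update_of_ne (by omega),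
          Function.update_of_ne (by omega), hy]) hxb hyb (by rw [Function.update_self]),
        exists_sufs_iff]
      simp only [eval_sym, eval_nil, List.head?_cons]
      congr)
  unfold countVotes
  rw [h1]
  clear h1 hV
  induction V with
  | nil => rfl
  | cons v V ih =>
    simp only [sufs, List.flatMap_cons, ih, List.head?_cons, List.countP_cons]
    by_cases h : v.symm i ≤ v.symm j
    · simp [h, ones_one, ones_add, Nat.add_comm]
    · simp [h]

/-- The net advantage may be computed with nonstrict comparisons, which agree with the strict ones
for distinct candidates. -/
theorem netadv_eq {m : ℕ} (V : List (Equiv.Perm (Fin m))) (i j : Fin m) :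
    netadv V i j = ((V.countP fun v => decide (v.symm i ≤ v.symm j) : ℕ) : ℤ) -
      (V.countP fun v => decide (v.symm j ≤ v.symm i) : ℕ) := by
  unfold netadv adv
  by_cases h : i = j
  · simp [h]
  · have : ∀ (v : Equiv.Perm (Fin m)) (a b : Fin m), a ≠ b →
        decide (v.symm a < v.symm b) = decide (v.symm a ≤ v.symm b) := by
      intro v a b hab
      rw [decide_eq_decide]
      exact ⟨le_of_lt, fun h => lt_of_le_of_ne h fun e => hab (v.symm.injective e)⟩
    simp only [this _ _ _ h, this _ _ _ (Ne.symm h)]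

theorem holds_edge {m x y w : ℕ} {i j : Fin m} (hx : env x = ones i) (hy : env y = ones j)
    (hxb : x < 30) (hyb : y < 30) {V : List (Equiv.Perm (Fin m))} (hV : env 5 = encVotes V)
    (hw : env 7 = ones w) : (edge x y).Holds O env ↔ Strong V w i j := by
  unfold edge Strong
  rw [holds_drop, eval_app, eval_app, eval_countVotes hx hy hxb hyb hV,
    eval_countVotes hy hx hyb hxb hV, eval_sym, eval_var, hw, netadv_eq]
  simp only [List.length_append, length_ones, List.length_singleton]
  omega

end Expr

/-! ### Cut instances and their properties -/

/-- The graph whose cuts with budget `0` decide whether there is a conflict between `u` and `v`: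
the vertices other than these two and those in `C` are isolated, and there is an edge from `v` to
`u`. -/
def conflictGraph {m : ℕ} (E : Fin m → Fin m → Prop) (C : Finset (Fin m)) (u v : Fin m) :
    Digraph (Fin m) where
  Adj x y := (E x y ∧ (x ∈ C ∨ x = u ∨ x = v) ∧ (y ∈ C ∨ y = u ∨ y = v)) ∨ (x = v ∧ y = u)

theorem not_yes_conflictGraph {m : ℕ} {E : Fin m → Fin m → Prop} {C : Finset (Fin m)}
    {u v : Fin m} (h : u ≠ v) :
    ¬ pathPreservingVertexCut.Yes ⟨m, conflictGraph E C u v, u, v, h, 0⟩ ↔ Conflict E C u v := by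
  have hiff : pathPreservingVertexCut.Yes ⟨m, conflictGraph E C u v, u, v, h, 0⟩ ↔
      ¬ HasPathAvoiding (conflictGraph E C u v) ∅ u v := by
    constructor
    · rintro ⟨X, hX, -, hc⟩
      rwa [Finset.card_eq_zero.1 (Nat.le_zero.1 hX)] at hc
    · intro hc
      exact ⟨∅, by simp, ⟨by simp, by simp, Relation.ReflTransGen.single
        ⟨Or.inr ⟨rfl, rfl⟩, by simp, by simp⟩⟩, hc⟩
  rw [hiff, not_not]
  constructor
  · rintro ⟨-, -, hp⟩
    have key : ∀ z, Relation.ReflTransGen (fun x y => (conflictGraph E C u v).Adj x y ∧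
        x ∉ (∅ : Finset (Fin m)) ∧ y ∉ (∅ : Finset (Fin m))) u z →
        Conflict E C u v ∨ Conn E ((C : Set (Fin m)) ∪ {u, v}) u z := by
      intro z hz
      induction hz with
      | refl => exact Or.inr (Conn.refl u)
      | tail _ hyz ih =>
        rcases ih with ih | ih
        · exact Or.inl ih
        · rcases hyz.1 with ⟨h1, h2, h3⟩ | ⟨rfl, rfl⟩
          · exact Or.inr (Relation.ReflTransGen.tail ih
              ⟨h1, by simpa [or_comm, or_assoc] using h2, by simpa [or_comm, or_assoc] using h3⟩)
          · exact Or.inl ih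
    rcases key v hp with h | h
    · exact h
    · exact h
  · intro hc
    refine ⟨by simp, by simp, Relation.ReflTransGen.mono ?_ _ _ hc⟩
    rintro x y ⟨h1, h2, h3⟩
    exact ⟨Or.inl ⟨h1, by simpa [or_comm, or_assoc] using h2,
      by simpa [or_comm, or_assoc] using h3⟩, by simp, by simp⟩

/-- The graph whose cuts compare the budget with `i`: besides an edge from vertex `1` to
vertex `0`, there are `i` disjoint paths from `0` to `1`. -/
def parallelGraph (i : ℕ) : Digraph (Fin (i + 2)) where
  Adj x y := (x.val = 0 ∧ 1 < y.val) ∨ (y.val = 1 ∧ 1 < x.val) ∨ (x.val = 1 ∧ y.val = 0)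

theorem yes_parallelGraph {i k : ℕ} :
    pathPreservingVertexCut.Yes ⟨i + 2, parallelGraph i, 0, 1, by simp, k⟩ ↔ i ≤ k := by
  constructor
  · rintro ⟨X, hX, ⟨h1, h0, -⟩, hc⟩
    have hsub : (Finset.univ : Finset (Fin i)).image (fun j : Fin i => (j.natAdd 2).cast
        (Nat.add_comm 2 i)) ⊆ X := by
      intro x hx
      by_contra hxX
      obtain ⟨j, -, rfl⟩ := Finset.mem_image.1 hx
      refine hc ⟨h0, h1, ((Relation.ReflTransGen.single
        ⟨Or.inl ⟨rfl, ?_⟩, h0, hxX⟩).tail ⟨Or.inr (Or.inl ⟨rfl, ?_⟩), hxX, h1⟩)⟩ <;> simp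
    have hcard := Finset.card_le_card hsub
    rw [Finset.card_image_of_injective _ (by
      intro x y hxy
      simpa using hxy), Finset.card_univ, Fintype.card_fin] at hcard
    exact hcard.trans hX
  · intro hik
    refine ⟨(Finset.univ : Finset (Fin i)).image (fun j : Fin i => (j.natAdd 2).cast
        (Nat.add_comm 2 i)), ?_, ⟨?_, ?_, Relation.ReflTransGen.single
          ⟨Or.inr (Or.inr ⟨rfl, rfl⟩), ?_, ?_⟩⟩, ?_⟩
    · exact Finset.card_image_le.trans (by simpa using hik)
    · simp [Fin.ext_iff]
    · simp [Fin.ext_iff]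
    · simp [Fin.ext_iff]
    · simp [Fin.ext_iff]
    · rintro ⟨-, -, h⟩
      have key : ∀ z : Fin (i + 2), Relation.ReflTransGen (fun x y => (parallelGraph i).Adj x y ∧
          x ∉ (Finset.univ : Finset (Fin i)).image (fun j : Fin i => (j.natAdd 2).cast
            (Nat.add_comm 2 i)) ∧
          y ∉ (Finset.univ : Finset (Fin i)).image (fun j : Fin i => (j.natAdd 2).cast
            (Nat.add_comm 2 i))) 0 z → z.val = 0 := by
        intro z hz
        induction hz with
        | refl => rfl
        | @tail y z _ hyz ih =>
          obtain ⟨h1, -, h2⟩ := hyz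
          rcases h1 with ⟨-, h3⟩ | ⟨-, h3⟩ | ⟨h3, -⟩
          · exact absurd (Finset.mem_image.2 ⟨⟨z.val - 2, by omega⟩, Finset.mem_univ _, by
              simp [Fin.ext_iff]; omega⟩) h2
          · omega
          · omega
      exact absurd (key _ h) (by simp)

theorem encodePosNum_iterate (n : ℕ) :
    encodePosNum (PosNum.bit1^[n] PosNum.one) = List.replicate (n + 1) true := by
  induction n with
  | zero => rfl
  | succ n ih =>
    rw [Function.iterate_succ_apply', encodePosNum, ih]
    rfl

theorem le_iterate_bit1 (n : ℕ) : n + 1 ≤ ((PosNum.bit1^[n] PosNum.one : PosNum) : ℕ) := by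
  induction n with
  | zero => simp
  | succ n ih =>
    rw [Function.iterate_succ_apply', PosNum.cast_bit1]
    omega

/-- The string of `n` ones is the binary notation of a number that is at least `n`. So a budget that
is at least the number of vertices can be written down without any arithmetic. -/
theorem exists_encBinary {n : ℕ} (hn : 0 < n) :
    ∃ K, n ≤ K ∧ encBinary K = Expr.ones n ++ [Γ'.comma] := by
  obtain ⟨n, rfl⟩ := Nat.exists_eq_succ_of_ne_zero hn.ne'
  refine ⟨_, le_iterate_bit1 n, ?_⟩
  unfold encBinary encodeNat
  rw [PosNum.of_to_nat, encodeNum, encodePosNum_iterate, List.map_replicate]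
  rfl

section LayeredCut

variable {m : ℕ} (E : Fin m → Fin m → Prop) (C : Finset (Fin m)) (a p : Fin m) (κ : ℕ)

/-- The numbering of the vertices of the layered graph. -/
def layeredEquiv (m κ : ℕ) : Bool × Fin m × Fin (κ + 1) ≃ Fin (2 * (m * (κ + 1))) :=
  (finTwoEquiv.symm.prodCongr finProdFinEquiv).trans finProdFinEquiv

theorem layeredEquiv_false (v : Fin m) (i : Fin (κ + 1)) :
    (layeredEquiv m κ (false, v, i) : ℕ) = v * (κ + 1) + i := by
  simp [layeredEquiv, finTwoEquiv]
  ring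

theorem layeredEquiv_true (v : Fin m) (i : Fin (κ + 1)) :
    (layeredEquiv m κ (true, v, i) : ℕ) = m * (κ + 1) + (v * (κ + 1) + i) := by
  simp [layeredEquiv, finTwoEquiv]
  ring

/-- The layered graph with numbered vertices. -/
def layeredGraph : Digraph (Fin (2 * (m * (κ + 1)))) where
  Adj x y := Layered E C a p κ ((layeredEquiv m κ).symm x) ((layeredEquiv m κ).symm y)

variable {E C a p κ}

theorem conn_equiv_iff {α β : Type*} (e : α ≃ β) {R : α → α → Prop} {Y : Set α} {x y : α} :
    Relation.ReflTransGen (fun x y => R (e.symm x) (e.symm y) ∧ e.symm x ∈ Y ∧ e.symm y ∈ Y)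
      (e x) (e y) ↔ Conn R Y x y := by
  constructor
  · intro h
    have := Relation.ReflTransGen.lift (p := fun x y => R x y ∧ x ∈ Y ∧ y ∈ Y) e.symm
      (fun _ _ h => h) _ _ h
    simpa [Conn, Function.onFun] using this
  · intro h
    exact Relation.ReflTransGen.lift e (fun _ _ h => by simpa [Function.onFun] using h) _ _ h

theorem yes_layeredGraph {K : ℕ} (hK : 2 * (m * (κ + 1)) ≤ K) (hp : p ∈ C)
    (hst : layeredEquiv m κ (true, p, Fin.last κ) ≠ layeredEquiv m κ (false, a, 0)) :
    pathPreservingVertexCut.Yes ⟨2 * (m * (κ + 1)), layeredGraph E C a p κ,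
      layeredEquiv m κ (true, p, Fin.last κ), layeredEquiv m κ (false, a, 0), hst, K⟩ ↔
    ∃ D : Finset (Fin m), D ⊆ Cᶜ ∧ D.card ≤ κ ∧ a ∈ C ∪ D ∧
      Conn E (C ∪ D : Finset (Fin m)) a p ∧ ¬ Conn E (C ∪ D : Finset (Fin m)) p a := by
  classical
  constructor
  · rintro ⟨X, -, ⟨ht, hs, h⟩, h'⟩
    refine exists_added_of_cut (κ := κ) hp (Y := {z | layeredEquiv m κ z ∉ X}) ht hs ?_ ?_
    · rw [← conn_equiv_iff (layeredEquiv m κ)]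
      simpa [layeredGraph] using h
    · rw [← conn_equiv_iff (layeredEquiv m κ)]
      intro hc
      exact h' ⟨hs, ht, by simpa [layeredGraph] using hc⟩
  · rintro ⟨D, -, hD, ha, h, h'⟩
    obtain ⟨Y, ht, hs, hY, hY'⟩ := exists_cut_of_added hp hD ha h h'
    rw [← conn_equiv_iff (layeredEquiv m κ)] at hY hY'
    refine ⟨Finset.univ.filter fun x => (layeredEquiv m κ).symm x ∉ Y, ?_, ⟨?_, ?_, ?_⟩, ?_⟩
    · exact (Finset.card_le_univ _).trans (by simpa using hK)
    · simpa using ht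
    · simpa using hs
    · simpa [layeredGraph] using hY
    · rintro ⟨-, -, hc⟩
      exact hY' (by simpa [layeredGraph] using hc)

end LayeredCut

namespace Expr

/-! ### Writing and asking cut instances -/

/-- The adjacency matrix of a graph, where the value of the variable `n` is the number of
vertices in unary and `e` tests the adjacency of the vertices `x` and `y`. -/
def matrix (n x y : ℕ) (e : Expr) : Expr :=
  forU x (var n) (app (forU y (var n) (bitE e)) (sym Γ'.comma))

/-- The encoding of a cut instance, composed of its parts, which come without their separators:
the number `n` of vertices, the vertices `s` and `t`, the budget `k` and the matrix `g`. -/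
def cutQuery (n s t k g : Expr) : Expr :=
  app (app n (sym Γ'.comma)) (app (app s (sym Γ'.comma)) (app (app t (sym Γ'.comma))
    (app (app k (sym Γ'.comma)) g)))

variable {O : Set (List TMSymbol)} {env : ℕ → List TMSymbol}

theorem encGraph_eq {n : ℕ} (G : Digraph (Fin n)) [∀ i j, Decidable (G.Adj i j)] :
    encGraph G = (List.finRange n).flatMap fun i =>
      ((List.finRange n).flatMap fun j => [Γ'.bit (decide (G.Adj i j))]) ++ [Γ'.comma] := by
  unfold encGraph
  rw [List.ofFn_eq_map, ← List.flatMap_def]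
  congr
  funext i
  rw [List.ofFn_eq_map, List.map_eq_flatMap]
  congr 1
  refine List.flatMap_congr fun j _ => ?_
  congr

theorem eval_matrix {n x y k : ℕ} {e : Expr} (hn : env n = ones k) (hnx : n ≠ x) (hn' : n ≠ 99)
    {G : Digraph (Fin k)} (he : ∀ (i j : Fin k) (l l' : List TMSymbol),
      e.Holds O (Function.update (Function.update (Function.update (Function.update env x (ones i))
        99 l) y (ones j)) 99 l') ↔ G.Adj i j) :
    (matrix n x y e).eval O env = encGraph G := by
  classical
  rw [encGraph_eq]
  unfold matrix
  rw [eval_forU (n := k) (by rw [eval_var, hn])]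
  congr
  funext i
  rw [eval_app, eval_forU (n := k) (by
    rw [eval_var, Function.update_of_ne hn', Function.update_of_ne hnx, hn])]
  congr
  funext j
  rw [eval_bitE]
  simp only [he]

theorem holds_ask_cutQuery {n s t k g : Expr} (I : CutInst) (hn : n.eval O env = ones I.n)
    (hs : s.eval O env = ones I.s) (ht : t.eval O env = ones I.t)
    (hk : k.eval O env ++ [Γ'.comma] = encBinary I.k) (hg : g.eval O env = encGraph I.G)
    (hO : O = pathPreservingVertexCut.language) :
    (ask (cutQuery n s t k g)).Holds O env ↔ pathPreservingVertexCut.Yes I := by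
  have : (cutQuery n s t k g).eval O env = pathPreservingVertexCut.encode I := by
    simp only [cutQuery, eval_app, eval_sym, hn, hs, ht, hk, hg]
    rfl
  rw [holds_ask, this, hO]
  constructor
  · rintro ⟨J, hJ, hY⟩
    exact pathPreservingVertexCut.encode_injective hJ ▸ hY
  · intro h
    exact ⟨I, rfl, h⟩

/-! ### Reading the parts of an instance -/

/-- Read a string terminated by a comma from the unread part of the input, which is the value of
the variable `8`, and let it be the value of `x` in `e`. -/
def field (x : ℕ) (e : Expr) : Expr :=
  letE x (takeTo Γ'.comma (var 8)) (letE 8 (drop (var 8) (app (var x) (sym Γ'.comma))) e)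

theorem holds_field {x : ℕ} {e : Expr} (hx : x ≠ 8) {l r : List TMSymbol} (hl : Γ'.comma ∉ l)
    (h : env 8 = l ++ Γ'.comma :: r) : (field x e).Holds O env ↔
      e.Holds O (Function.update (Function.update env x l) 8 r) := by
  unfold field
  rw [holds_letE, holds_letE, eval_takeTo, eval_var, h, takeWhile_ne_append hl, eval_drop,
    eval_app, eval_var, eval_var, eval_sym, Function.update_self,
    Function.update_of_ne (Ne.symm hx), h]
  simp

/-! ### Candidates and thresholds -/

/-- For some candidate `6` other than the candidate `3` and some positive threshold `7`, which is
at most the number of voters, the oracle answers the query `q` positively. The threshold runs over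
the nonempty suffixes of a unary number, since each vote contains one closing bracket. -/
def search (q : Expr) : Expr :=
  forU 6 (var 1) (and (not (eqLen (var 6) (var 3))) (zip 98 7 (occ Γ'.ket (var 5)) (ask q)))

theorem count_ket_encVotes {m : ℕ} (V : List (Equiv.Perm (Fin m))) :
    (encVotes V).count Γ'.ket = V.length := by
  have h : ∀ v : Equiv.Perm (Fin m), (encVote v).count Γ'.ket = 1 := by
    intro v
    have : ((List.ofFn v).flatMap fun i : Fin m => encUnary i).count Γ'.ket = 0 := by
      rw [List.count_eq_zero]
      simp [encUnary]
    simp [encVote, List.count_append, this]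
  induction V with
  | nil => rfl
  | cons v V ih =>
    unfold encVotes at *
    rw [List.flatMap_cons, List.count_append, h, ih, List.length_cons, Nat.add_comm]

theorem holds_search {m : ℕ} {p : Fin m} {V : List (Equiv.Perm (Fin m))} {q : Expr}
    {P : Fin m → ℕ → Prop} (h1 : env 1 = ones m) (h3 : env 3 = ones p) (h5 : env 5 = encVotes V)
    (hq : ∀ (a : Fin m) (w : ℕ) (env' : ℕ → List TMSymbol), a ≠ p → env' 6 = ones a →
      env' 7 = ones w → (∀ x, x ≠ 6 → x ≠ 7 → x < 98 → env' x = env x) →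
      ((ask q).Holds O env' ↔ P a w)) :
    (search q).Holds O env ↔ ∃ a w, a ≠ p ∧ 1 ≤ w ∧ w ≤ V.length ∧ P a w := by
  have hs : ∀ n, splits [] (ones n) = (List.range n).map fun i => (ones i, ones (n - i)) := by
    intro n
    have := splits_ones 0 n
    simp only [Nat.zero_add] at this
    exact this
  unfold search
  rw [holds_forU (n := m) (by rw [eval_var, h1])]
  refine exists_congr fun a => ?_
  have hocc : ∀ env' : ℕ → List TMSymbol, env' 5 = encVotes V →
      (occ Γ'.ket (var 5)).eval O env' = ones V.length := by
    intro env' h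
    rw [eval_occ, eval_var, h, ← count_ket_encVotes V]
  rw [holds_and, holds_not, holds_eqLen, eval_var, eval_var, holds_zip,
    hocc _ (by simp [h5]), hs]
  have hap : ¬ ((ones a).length = (ones p).length) ↔ a ≠ p := by
    simp [Fin.ext_iff]
  have h3' : (Function.update (Function.update env 6 (ones a)) 99 (ones (m - a))) 3 = ones p := by
    simp [h3]
  have h6' : (Function.update (Function.update env 6 (ones a)) 99 (ones (m - a))) 6 = ones a := by
    simp
  rw [h3', h6', hap]
  have hother : ∀ (l l' : List TMSymbol) (x : ℕ), x ≠ 6 → x ≠ 7 → x < 98 →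
      Function.update (Function.update (Function.update (Function.update env 6 (ones a)) 99
        (ones (m - a))) 98 l) 7 l' x = env x := by
    intro l l' x h6 h7 h98
    rw [Function.update_of_ne h7, Function.update_of_ne (by omega),
      Function.update_of_ne (by omega), Function.update_of_ne h6]
  simp only [List.mem_map, List.mem_range, exists_exists_and_eq_and]
  constructor
  · rintro ⟨hne, i, hi, h⟩
    refine ⟨V.length - i, hne, by omega, by omega,
      (hq a _ _ hne ?_ (Function.update_self ..) (hother _ _)).1 h⟩
    simp
  · rintro ⟨w, hne, hw, hw', h⟩
    refine ⟨hne, V.length - w, by omega, (hq a w _ hne ?_ ?_ (hother _ _)).2 h⟩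
    · simp
    · rw [Function.update_self]
      congr 1
      omega

/-! ### Control by deleting candidates -/

/-- Recognition of the yes-instances of control by deleting candidates. The variables `1`, `3`,
`4` and `5` stand for the number of candidates, the distinguished candidate, the deleting limit,
and the votes. -/
def deleting : Expr :=
  field 1 (field 3 (field 4 (letE 5 (var 8)
    (search (cutQuery (var 1) (var 3) (var 6) (var 4) (matrix 1 10 11 (edge 10 11)))))))

theorem comma_notMem_map_bit (l : List Bool) : Γ'.comma ∉ l.map Γ'.bit := by simp

theorem holds_deleting (I : DeleteInst) (hO : O = pathPreservingVertexCut.language) :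
    deleting.Holds O (fun _ => destructiveDeleting.encode I) ↔ destructiveDeleting.Yes I := by
  classical
  obtain ⟨m, p, k, V⟩ := I
  have henc : destructiveDeleting.encode ⟨m, p, k, V⟩ = ones m ++ Γ'.comma :: (ones p ++
      Γ'.comma :: ((encodeNat k).map Γ'.bit ++ Γ'.comma :: encVotes V)) := by
    simp [destructiveDeleting, encUnary_eq, encBinary]
  unfold deleting
  rw [henc, holds_field (by decide) (comma_notMem_ones m) rfl,
    holds_field (by decide) (comma_notMem_ones p) (by rw [Function.update_self]),
    holds_field (by decide) (comma_notMem_map_bit _) (by rw [Function.update_self]), holds_letE,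
    holds_search (m := m) (p := p) (V := V) (P := fun a w => ∃ D : Finset (Fin m), D.card ≤ k ∧
      (a ∉ D ∧ p ∉ D ∧ Conn (Strong V w) (Dᶜ : Finset (Fin m)) a p) ∧
        ¬ (p ∉ D ∧ a ∉ D ∧ Conn (Strong V w) (Dᶜ : Finset (Fin m)) p a))
      (by simp) (by simp)
      (by simp [eval_var])]
  · change _ ↔ ∃ D : Finset (Fin m), p ∉ D ∧ D.card ≤ k ∧ ¬ IsSchulzeWinner Dᶜ V p
    constructor
    · rintro ⟨a, w, hap, hw, hw', D, hD, ⟨ha, hp, h⟩, h'⟩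
      exact ⟨D, hp, hD, (not_isSchulzeWinner_iff (by simpa using hp)).2
        ⟨a, w, hap, hw, hw', by simpa using ha, h, fun hc => h' ⟨hp, ha, hc⟩⟩⟩
    · rintro ⟨D, hp, hD, h⟩
      obtain ⟨a, w, hap, hw, hw', ha, h, h'⟩ := (not_isSchulzeWinner_iff (by simpa using hp)).1 h
      exact ⟨a, w, hap, hw, hw', D, hD, ⟨by simpa using ha, hp, h⟩, fun hc => h' hc.2.2⟩
  · intro a w env' hap h6 h7 henv
    have h1 : env' 1 = ones m := by
      rw [henv 1 (by omega) (by omega) (by omega)]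
      simp
    have h3 : env' 3 = ones p := by
      rw [henv 3 (by omega) (by omega) (by omega)]
      simp
    have h4 : env' 4 = (encodeNat k).map Γ'.bit := by
      rw [henv 4 (by omega) (by omega) (by omega)]
      simp
    have h5 : env' 5 = encVotes V := by
      rw [henv 5 (by omega) (by omega) (by omega)]
      simp [eval_var]
    -- cutting candidates of the threshold graph means deleting them from the election
    rw [holds_ask_cutQuery (n := var 1) (s := var 3) (t := var 6) (k := var 4)
      ⟨m, ⟨Strong V w⟩, p, a, hap.symm, k⟩ h1 h3 h6 (by rw [eval_var, h4]; rfl)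
      (eval_matrix (n := 1) h1 (by decide) (by decide) fun i j l l' =>
        holds_edge (by simp) (by simp) (by decide)
          (by decide) (by simp [h5])
          (by simp [h7])) hO]
    simp only [Conn, Finset.coe_compl, Set.mem_compl_iff, Finset.mem_coe]
    rfl

end Expr

namespace Expr

/-! ### Control by adding candidates: the layered query -/

/-- The candidate given by the variable `x` is in the set whose characteristic string is an
initial segment of the value of the variable `2`. -/
def inC (x : ℕ) : Expr := letE 42 (drop (var 2) (var x)) (hd 42 (Γ'.bit true))

/-- The adjacency of the vertices `14` and `15` in the graph that decides whether there is a
conflict between the candidates `10` and `11`. -/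
def conflictAdj : Expr :=
  app (and (edge 14 15)
      (and (app (inC 14) (app (eqLen (var 14) (var 10)) (eqLen (var 14) (var 11))))
        (app (inC 15) (app (eqLen (var 15) (var 10)) (eqLen (var 15) (var 11))))))
    (and (eqLen (var 14) (var 11)) (eqLen (var 15) (var 10)))

/-- There is a conflict between the candidates `10` and `11`. -/
def conflict : Expr :=
  app (eqLen (var 10) (var 11))
    (not (ask (cutQuery (var 1) (var 10) (var 11) nil (matrix 1 14 15 conflictAdj))))

/-- The candidate `10` may be left, in order to get from layer `12` to layer `13`. -/
def affordable : Expr :=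
  ite (inC 10) (not (drop (var 12) (var 13))) (drop (var 13) (var 12))

/-- There is an edge from candidate `10` in layer `12` to candidate `11` in layer `13`. -/
def layerEdge : Expr := and (edge 10 11) affordable

/-- The part of a row of the adjacency matrix of the layered graph that belongs to one of the two
copies of the candidates, where `e` tests the adjacency. -/
def block (e : Expr) : Expr := forU 11 (var 1) (forU 13 (var 9) (bitE e))

/-- Those rows of the adjacency matrix of the layered graph which belong to one of the two copies
of the candidates, where `e` and `f` test the adjacency to vertices of the first and second copy. -/
def half (e f : Expr) : Expr :=
  forU 10 (var 1) (forU 12 (var 9) (app (app (block e) (block f)) (sym Γ'.comma)))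

/-- The number of vertices of the layered graph, in unary. -/
def layeredSize : Expr :=
  forU 21 (app (sym (Γ'.bit true)) (sym (Γ'.bit true))) (forU 20 (var 1) (var 9))

/-- The cut instance given by the layered graph. The budget is written as a string of as many binary
ones as there are vertices, so that it allows to cut all of them. The vertex numbers follow
`layeredEquiv`. -/
def layeredQuery : Expr :=
  cutQuery layeredSize
    (app (forU 20 (var 1) (var 9)) (app (forU 20 (var 3) (var 9))
      (drop (var 9) (sym (Γ'.bit true)))))
    (forU 20 (var 6) (var 9))
    layeredSize
    (app (half (app layerEdge (eqLen (var 11) (var 6))) layerEdge)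
      (half conflict (app layerEdge (eqLen (var 10) (var 3)))))

variable {O : Set (List TMSymbol)} {env : ℕ → List TMSymbol}
  {m : ℕ} {C : Finset (Fin m)} {p a : Fin m} {κ w : ℕ} {V : List (Equiv.Perm (Fin m))}

/-- The values of the variables used by the layered query: `1` is the number of candidates, `2`
begins with the registered candidates, `3` is the distinguished candidate, `5` the votes, `6` the
candidate that is to beat `3`, `7` the threshold, and `9` the number of layers. -/
structure AddContext (C : Finset (Fin m)) (p a : Fin m) (κ w : ℕ)
    (V : List (Equiv.Perm (Fin m))) (env : ℕ → List TMSymbol) : Prop where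
  size : env 1 = ones m
  registered : ∃ r, env 2 = encSet C ++ r
  distinguished : env 3 = ones p
  votes : env 5 = encVotes V
  rival : env 6 = ones a
  threshold : env 7 = ones w
  layers : env 9 = ones (κ + 1)

theorem AddContext.update (h : AddContext C p a κ w V env) {x : ℕ} (hx : 9 < x)
    (l : List TMSymbol) : AddContext C p a κ w V (Function.update env x l) := by
  obtain ⟨h1, h2, h3, h5, h6, h7, h9⟩ := h
  constructor <;> rw [Function.update_of_ne (by omega)] <;> assumption

theorem holds_inC (h : AddContext C p a κ w V env) {x : ℕ} {i : Fin m} (hx : env x = ones i) :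
    (inC x).Holds O env ↔ i ∈ C := by
  obtain ⟨r, hr⟩ := h.registered
  unfold inC
  rw [holds_letE, holds_hd, Function.update_self, eval_drop, eval_var, eval_var, hx, hr,
    length_ones, List.head?_drop, List.getElem?_append_left (by simp [encSet])]
  simp [encSet]

theorem eqLen_var {n x y : ℕ} {i j : Fin n} (hx : env x = ones i) (hy : env y = ones j) :
    (eqLen (var x) (var y)).Holds O env ↔ i = j := by
  rw [holds_eqLen, eval_var, eval_var, hx, hy, length_ones, length_ones, Fin.ext_iff]

theorem holds_conflictAdj (h : AddContext C p a κ w V env) {u v x y : Fin m}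
    (hu : env 10 = ones u) (hv : env 11 = ones v) (hx : env 14 = ones x) (hy : env 15 = ones y) :
    conflictAdj.Holds O env ↔ (conflictGraph (Strong V w) C u v).Adj x y := by
  unfold conflictAdj
  simp only [holds_app, holds_and, holds_edge hx hy (by decide) (by decide) h.votes h.threshold,
    holds_inC h hx, holds_inC h hy, eqLen_var hx hu, eqLen_var hx hv, eqLen_var hy hu,
    eqLen_var hy hv]
  rfl

theorem holds_conflict (hO : O = pathPreservingVertexCut.language)
    (h : AddContext C p a κ w V env) {u v : Fin m} (hu : env 10 = ones u) (hv : env 11 = ones v) :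
    conflict.Holds O env ↔ Conflict (Strong V w) C u v := by
  unfold conflict
  rw [holds_app, eqLen_var hu hv, holds_not]
  by_cases huv : u = v
  · subst huv
    simp only [true_or, true_iff]
    exact Conn.refl u
  · rw [holds_ask_cutQuery (n := var 1) (s := var 10) (t := var 11) (k := nil)
      ⟨m, conflictGraph (Strong V w) C u v, u, v, huv, 0⟩ h.size hu hv rfl
      (eval_matrix (n := 1) h.size (by decide) (by decide) fun i j l l' =>
        holds_conflictAdj ((((h.update (by decide) _).update (by decide) _).update
          (by decide) _).update (by decide) _)
          (by simp [hu]) (by simp [hv]) (by simp) (by simp)) hO,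
      not_yes_conflictGraph huv]
    simp [huv]

theorem holds_layerEdge (h : AddContext C p a κ w V env) {u v : Fin m} {i j : ℕ}
    (hu : env 10 = ones u) (hv : env 11 = ones v) (hi : env 12 = ones i) (hj : env 13 = ones j) :
    layerEdge.Holds O env ↔ Strong V w u v ∧ Affordable C u i j := by
  unfold layerEdge affordable Affordable
  rw [holds_and, holds_edge hu hv (by decide) (by decide) h.votes h.threshold, holds_ite,
    holds_inC h hu, holds_not, holds_drop, holds_drop, eval_var, eval_var, hi, hj, length_ones,
    length_ones]
  by_cases hC : u ∈ C <;> simp [hC]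

/-! ### The adjacency matrix of the layered graph -/

theorem flatMap_finRange_mul {α : Type*} {m n : ℕ} (f : Fin (m * n) → List α) :
    (List.finRange (m * n)).flatMap f = (List.finRange m).flatMap fun i =>
      (List.finRange n).flatMap fun j => f (finProdFinEquiv (i, j)) := by
  have h : List.finRange (m * n) = (List.finRange m).flatMap fun i =>
      (List.finRange n).map fun j => finProdFinEquiv (i, j) := by
    rw [← List.ofFn_id, List.ofFn_mul, List.ofFn_eq_map, ← List.flatMap_def]
    refine List.flatMap_congr fun i _ => ?_
    rw [List.ofFn_eq_map]
    refine List.map_congr_left fun j _ => ?_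
    ext
    simp [Nat.mul_comm, Nat.add_comm]
  rw [h, List.flatMap_assoc]
  simp only [List.flatMap_map]

theorem flatMap_layeredEquiv {α : Type*} (f : Fin (2 * (m * (κ + 1))) → List α) :
    (List.finRange (2 * (m * (κ + 1)))).flatMap f =
      ((List.finRange m).flatMap fun u => (List.finRange (κ + 1)).flatMap fun i =>
        f (layeredEquiv m κ (false, u, i))) ++
      (List.finRange m).flatMap fun u => (List.finRange (κ + 1)).flatMap fun i =>
        f (layeredEquiv m κ (true, u, i)) := by
  rw [flatMap_finRange_mul]
  simp only [flatMap_finRange_mul (m := m)]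
  simp only [List.finRange_succ, List.finRange_zero, List.map_nil, List.map_cons,
    List.flatMap_cons, List.flatMap_nil, List.append_nil]
  rfl

open Classical in
theorem eval_block {e : Expr} {R : Fin m → Fin (κ + 1) → Prop} (h : AddContext C p a κ w V env)
    (he : ∀ (v : Fin m) (j : Fin (κ + 1)) (l l' : List TMSymbol),
      e.Holds O (Function.update (Function.update (Function.update (Function.update env 11
        (ones v)) 99 l) 13 (ones j)) 99 l') ↔ R v j) :
    (block e).eval O env = (List.finRange m).flatMap fun v =>
      (List.finRange (κ + 1)).flatMap fun j => [Γ'.bit (decide (R v j))] := by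
  unfold block
  rw [eval_forU (n := m) (by rw [eval_var, h.size])]
  refine List.flatMap_congr fun v _ => ?_
  rw [eval_forU (n := κ + 1) (by
    rw [eval_var, ((h.update (by decide) _).update (by decide) _).layers])]
  refine List.flatMap_congr fun j _ => ?_
  rw [eval_bitE]
  simp only [he]

open Classical in
theorem eval_half {e f : Expr} {R S : Fin m → Fin (κ + 1) → Fin m → Fin (κ + 1) → Prop}
    (h : AddContext C p a κ w V env)
    (he : ∀ (u : Fin m) (i : Fin (κ + 1)) (v : Fin m) (j : Fin (κ + 1))
      (env' : ℕ → List TMSymbol),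
      AddContext C p a κ w V env' → env' 10 = ones u → env' 11 = ones v → env' 12 = ones i →
      env' 13 = ones j → (e.Holds O env' ↔ R u i v j))
    (hf : ∀ (u : Fin m) (i : Fin (κ + 1)) (v : Fin m) (j : Fin (κ + 1))
      (env' : ℕ → List TMSymbol),
      AddContext C p a κ w V env' → env' 10 = ones u → env' 11 = ones v → env' 12 = ones i →
      env' 13 = ones j → (f.Holds O env' ↔ S u i v j)) :
    (half e f).eval O env = (List.finRange m).flatMap fun u =>
      (List.finRange (κ + 1)).flatMap fun i =>
        (((List.finRange m).flatMap fun v => (List.finRange (κ + 1)).flatMap fun j =>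
          [Γ'.bit (decide (R u i v j))]) ++
        (List.finRange m).flatMap fun v => (List.finRange (κ + 1)).flatMap fun j =>
          [Γ'.bit (decide (S u i v j))]) ++ [Γ'.comma] := by
  unfold half
  rw [eval_forU (n := m) (by rw [eval_var, h.size])]
  refine List.flatMap_congr fun u _ => ?_
  have h1 := (h.update (by decide : 9 < 10) (ones u)).update (by decide : 9 < 99) (ones (m - u))
  rw [eval_forU (n := κ + 1) (by rw [eval_var, h1.layers])]
  refine List.flatMap_congr fun i _ => ?_
  have h2 := (h1.update (by decide : 9 < 12) (ones i)).update (by decide : 9 < 99)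
    (ones (κ + 1 - i))
  rw [eval_app, eval_app, eval_sym,
    eval_block h2 fun v j l l' => he u i v j _ ((((h2.update (by decide) _).update (by decide)
      _).update (by decide) _).update (by decide) _) (by simp) (by simp) (by simp) (by simp),
    eval_block h2 fun v j l l' => hf u i v j _ ((((h2.update (by decide) _).update (by decide)
      _).update (by decide) _).update (by decide) _) (by simp) (by simp) (by simp) (by simp)]

theorem eval_layeredMatrix (hO : O = pathPreservingVertexCut.language)
    (h : AddContext C p a κ w V env) :
    (app (half (app layerEdge (eqLen (var 11) (var 6))) layerEdge)
      (half conflict (app layerEdge (eqLen (var 10) (var 3))))).eval O env =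
      encGraph (layeredGraph (Strong V w) C a p κ) := by
  classical
  rw [encGraph_eq, flatMap_layeredEquiv, eval_app]
  simp only [flatMap_layeredEquiv]
  simp only [layeredGraph, Equiv.symm_apply_apply]
  congr 1
  · refine eval_half h ?_ ?_
    · intro u i v j env' h' hu hv hi hj
      rw [holds_app, holds_layerEdge h' hu hv hi hj, eqLen_var hv h'.rival]
      rfl
    · intro u i v j env' h' hu hv hi hj
      rw [holds_layerEdge h' hu hv hi hj]
      rfl
  · refine eval_half h ?_ ?_
    · intro u i v j env' h' hu hv hi hj
      rw [holds_conflict hO h' hu hv]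
      rfl
    · intro u i v j env' h' hu hv hi hj
      rw [holds_app, holds_layerEdge h' hu hv hi hj, eqLen_var hu h'.distinguished]
      rfl

/-! ### The answer to the layered query -/

theorem eval_forU_layers (h : AddContext C p a κ w V env) {x n : ℕ} (hx : env x = ones n) :
    (forU 20 (var x) (var 9)).eval O env = ones (n * (κ + 1)) :=
  eval_forU_const (by rw [eval_var, hx]) fun l l' => by
    rw [eval_var, ((h.update (by decide) _).update (by decide) _).layers]

theorem eval_layeredSize (h : AddContext C p a κ w V env) :
    layeredSize.eval O env = ones (2 * (m * (κ + 1))) :=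
  eval_forU_const rfl fun l l' => by
    have h' := (h.update (by decide : 9 < 21) l).update (by decide : 9 < 99) l'
    rw [eval_forU_layers h' h'.size]

theorem holds_layeredQuery (hO : O = pathPreservingVertexCut.language) (hp : p ∈ C)
    (h : AddContext C p a κ w V env) :
    (ask layeredQuery).Holds O env ↔ ∃ D : Finset (Fin m), D ⊆ Cᶜ ∧ D.card ≤ κ ∧ a ∈ C ∪ D ∧
      Conn (Strong V w) (C ∪ D : Finset (Fin m)) a p ∧
        ¬ Conn (Strong V w) (C ∪ D : Finset (Fin m)) p a := by
  have hm : 0 < m := p.pos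
  obtain ⟨K, hK, hKe⟩ := exists_encBinary (n := 2 * (m * (κ + 1))) (by positivity)
  have hst : layeredEquiv m κ (true, p, Fin.last κ) ≠ layeredEquiv m κ (false, a, 0) := by simp
  rw [← yes_layeredGraph hK hp hst]
  unfold layeredQuery
  refine holds_ask_cutQuery ⟨_, layeredGraph (Strong V w) C a p κ, _, _, hst, K⟩
    (eval_layeredSize h) ?_ ?_ ?_ (eval_layeredMatrix hO h) hO
  · rw [eval_app, eval_app, eval_forU_layers h h.size, eval_forU_layers h h.distinguished,
      eval_drop, eval_var, h.layers, eval_sym, drop_ones, ones_add, ones_add]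
    simp [layeredEquiv_true]
  · rw [eval_forU_layers h h.rival]
    simp [layeredEquiv_false]
  · rw [eval_layeredSize h, hKe]

/-- The search with the layered query decides whether `p` can be prevented from winning by adding
at most `κ` candidates. -/
theorem holds_search_layeredQuery (hO : O = pathPreservingVertexCut.language) (hp : p ∈ C)
    (h1 : env 1 = ones m) {r : List TMSymbol} (h2 : env 2 = encSet C ++ r) (h3 : env 3 = ones p)
    (h5 : env 5 = encVotes V) (h9 : env 9 = ones (κ + 1)) :
    (search layeredQuery).Holds O env ↔
      ∃ D : Finset (Fin m), D ⊆ Cᶜ ∧ D.card ≤ κ ∧ ¬ IsSchulzeWinner (C ∪ D) V p := by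
  have key := holds_search (O := O) (q := layeredQuery) h1 h3 h5 fun a w env' _ h6 h7 henv =>
    holds_layeredQuery (C := C) (κ := κ) (V := V) hO hp
      ⟨by rw [henv 1 (by decide) (by decide) (by decide), h1],
        ⟨r, by rw [henv 2 (by decide) (by decide) (by decide), h2]⟩,
        by rw [henv 3 (by decide) (by decide) (by decide), h3],
        by rw [henv 5 (by decide) (by decide) (by decide), h5], h6, h7,
        by rw [henv 9 (by decide) (by decide) (by decide), h9]⟩
  rw [key]
  constructor
  · rintro ⟨a, w, hap, hw, hw', D, hD, hDκ, ha, h⟩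
    exact ⟨D, hD, hDκ, (not_isSchulzeWinner_iff (Finset.mem_union_left _ hp)).2
      ⟨a, w, hap, hw, hw', ha, h⟩⟩
  · rintro ⟨D, hD, hDκ, h⟩
    obtain ⟨a, w, hap, hw, hw', ha, h⟩ :=
      (not_isSchulzeWinner_iff (Finset.mem_union_left _ hp)).1 h
    exact ⟨a, w, hap, hw, hw', D, hD, hDκ, ha, h⟩

/-! ### Comparing the adding limit with the number of candidates -/

/-- The adjacency of the vertices `10` and `11` in a graph of parallel paths from vertex `0` to
vertex `1`. -/
def parallelAdj : Expr :=
  app (and (not (var 10)) (drop (var 11) (sym (Γ'.bit true))))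
    (app (and (eqLen (var 11) (sym (Γ'.bit true))) (drop (var 10) (sym (Γ'.bit true))))
      (and (eqLen (var 10) (sym (Γ'.bit true))) (not (var 11))))

/-- The number of layers for the adding limit `4`: one more than the smaller one of this limit and
the number `1` of candidates. The limit exceeds `i` if and only if it allows to cut `i + 1` parallel
paths, in a graph with `i + 3` vertices. -/
def layersE : Expr :=
  app (sym (Γ'.bit true)) (forU 43 (var 1) (letE 44 (app (var 43) (app (sym (Γ'.bit true))
    (app (sym (Γ'.bit true)) (sym (Γ'.bit true)))))
    (ask (cutQuery (var 44) nil (sym (Γ'.bit true)) (var 4) (matrix 44 10 11 parallelAdj)))))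

theorem holds_parallelAdj {i : ℕ} {x y : Fin (i + 2)} (hx : env 10 = ones x)
    (hy : env 11 = ones y) : parallelAdj.Holds O env ↔ (parallelGraph i).Adj x y := by
  have h0 : ∀ n : ℕ, ones n = [] ↔ n = 0 := by
    intro n
    rw [← List.length_eq_zero_iff, length_ones]
  unfold parallelAdj
  simp only [holds_app, holds_and, holds_not, holds_var, holds_drop, holds_eqLen, eval_var,
    eval_sym, hx, hy, length_ones, List.length_singleton, ne_eq, not_not, h0]
  rfl

theorem eval_ask : ∀ {e : Expr}, (ask e).eval O env = [] ∨ (ask e).eval O env = ones 1 := by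
  intro e
  simp only [eval]
  split
  · exact Or.inr rfl
  · exact Or.inl rfl

theorem flatMap_finRange_lt (m k : ℕ) :
    ((List.finRange m).flatMap fun i : Fin m => if (i : ℕ) < k then ones 1 else []) =
      ones (min k m) := by
  induction m with
  | zero => simp [ones]
  | succ m ih =>
    rw [List.finRange_succ_last, List.flatMap_append, List.flatMap_map]
    simp only [Fin.val_castSucc, ih, List.flatMap_cons, List.flatMap_nil, List.append_nil,
      Fin.val_last]
    split
    · rw [ones_add]
      congr 1
      omega
    · rw [List.append_nil]
      congr 1
      omega

theorem eval_layersE (hO : O = pathPreservingVertexCut.language) {k : ℕ} (h1 : env 1 = ones m)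
    (h4 : env 4 = (encodeNat k).map Γ'.bit) :
    layersE.eval O env = ones (min k m + 1) := by
  unfold layersE
  rw [eval_app, eval_sym, ones_one, eval_forU (n := m) (by rw [eval_var, h1]), Nat.add_comm,
    ← ones_add, ← flatMap_finRange_lt]
  congr 1
  refine List.flatMap_congr fun i _ => ?_
  have h44 : ∀ env' : ℕ → List TMSymbol, env' 43 = ones i →
      (app (var 43) (app (sym (Γ'.bit true)) (app (sym (Γ'.bit true)) (sym (Γ'.bit true))))).eval O
        env' = ones (i + 1 + 2) := by
    intro env' h
    simp only [eval_app, eval_var, eval_sym, h, ones_one, ones_add]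
  rw [eval_letE, h44 _ (by simp)]
  have key := holds_ask_cutQuery (O := O) (env := Function.update (Function.update (Function.update
      env 43 (ones i)) 99 (ones (m - i))) 44 (ones (i + 1 + 2))) (n := var 44) (s := nil)
    (t := sym (Γ'.bit true)) (k := var 4) (g := matrix 44 10 11 parallelAdj)
    ⟨i + 1 + 2, parallelGraph (i + 1), 0, 1, by simp, k⟩ (by simp [eval_var]) rfl rfl
    (by simp [eval_var, h4, encBinary])
    (eval_matrix (n := 44) (by simp) (by decide) (by decide) fun x y l l' =>
      holds_parallelAdj (by simp) (by simp)) hO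
  rw [yes_parallelGraph] at key
  by_cases hik : (i : ℕ) < k
  · rw [if_pos hik]
    exact (eval_ask.resolve_left (key.2 hik))
  · rw [if_neg hik]
    by_contra hne
    exact hik (key.1 hne)

/-! ### Control by adding candidates -/

/-- Recognition of the yes-instances of control by adding candidates. -/
def adding : Expr :=
  field 1 (letE 2 (var 8) (letE 8 (drop (var 8) (var 1)) (field 3 (field 4 (letE 5 (var 8)
    (letE 9 layersE (search layeredQuery)))))))

/-- Recognition of the yes-instances of control by adding an unlimited number of candidates. -/
def unlimitedAdding : Expr :=
  field 1 (letE 2 (var 8) (letE 8 (drop (var 8) (var 1)) (field 3 (letE 5 (var 8)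
    (letE 9 (app (var 1) (sym (Γ'.bit true))) (search layeredQuery))))))

theorem drop_encSet_append {r l : List TMSymbol} (hl : l.length = m) :
    (encSet C ++ r).drop l.length = r := by
  rw [hl]
  exact List.drop_left' (by simp [encSet])

theorem holds_adding (I : AddInst) (hO : O = pathPreservingVertexCut.language) :
    adding.Holds O (fun _ => destructiveAdding.encode I) ↔ destructiveAdding.Yes I := by
  obtain ⟨m, C, p, hp, k, V⟩ := I
  have henc : destructiveAdding.encode ⟨m, C, p, hp, k, V⟩ = ones m ++ Γ'.comma :: (encSet C ++
      (ones p ++ Γ'.comma :: ((encodeNat k).map Γ'.bit ++ Γ'.comma :: encVotes V))) := by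
    simp [destructiveAdding, encUnary_eq, encBinary]
  unfold adding
  rw [henc, holds_field (by decide) (comma_notMem_ones m) rfl, holds_letE, holds_letE,
    holds_field (by decide) (comma_notMem_ones p) (by
      simp only [eval_drop, eval_var, Function.update_self]
      exact drop_encSet_append (by simp)),
    holds_field (by decide) (comma_notMem_map_bit _) (by rw [Function.update_self]), holds_letE,
    holds_letE, eval_layersE (m := m) (k := k) hO (by simp) (by simp),
    holds_search_layeredQuery (C := C) (p := p) (V := V) (κ := min k m) hO hp (by simp)
      (by simp [eval_var]; rfl) (by simp) (by simp [eval_var]) (by simp)]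
  change _ ↔ ∃ D : Finset (Fin m), D ⊆ Cᶜ ∧ D.card ≤ k ∧ ¬ IsSchulzeWinner (C ∪ D) V p
  refine exists_congr fun D => and_congr_right fun _ => and_congr_left fun _ => ?_
  have := (Finset.card_le_univ D).trans_eq (Fintype.card_fin m)
  omega

theorem holds_unlimitedAdding (I : UnlimitedAddInst) (hO : O = pathPreservingVertexCut.language) :
    unlimitedAdding.Holds O (fun _ => destructiveUnlimitedAdding.encode I) ↔
      destructiveUnlimitedAdding.Yes I := by
  obtain ⟨m, C, p, hp, V⟩ := I
  have henc : destructiveUnlimitedAdding.encode ⟨m, C, p, hp, V⟩ =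
      ones m ++ Γ'.comma :: (encSet C ++ (ones p ++ Γ'.comma :: encVotes V)) := by
    simp [destructiveUnlimitedAdding, encUnary_eq]
  unfold unlimitedAdding
  rw [henc, holds_field (by decide) (comma_notMem_ones m) rfl, holds_letE, holds_letE,
    holds_field (by decide) (comma_notMem_ones p) (by
      simp only [eval_drop, eval_var, Function.update_self]
      exact drop_encSet_append (by simp)), holds_letE, holds_letE,
    holds_search_layeredQuery (C := C) (p := p) (V := V) (κ := m) hO hp (by simp)
      (by simp [eval_var]; rfl) (by simp) (by simp [eval_var])
      (by simp [eval_app, eval_var, eval_sym, ones_one, ones_add])]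
  change _ ↔ ∃ D : Finset (Fin m), D ⊆ Cᶜ ∧ ¬ IsSchulzeWinner (C ∪ D) V p
  refine exists_congr fun D => and_congr_right fun _ => and_iff_right ?_
  exact (Finset.card_le_univ D).trans_eq (Fintype.card_fin m)

end Expr

/-! ### The three reductions -/

theorem mainTheorem10 :
    PolyTimeTuringReduces destructiveAdding pathPreservingVertexCut ∧
    PolyTimeTuringReduces destructiveUnlimitedAdding pathPreservingVertexCut ∧
    PolyTimeTuringReduces destructiveDeleting pathPreservingVertexCut :=
  ⟨Expr.polyTimeTuringReduces Expr.adding fun I => Expr.holds_adding I rfl,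
    Expr.polyTimeTuringReduces Expr.unlimitedAdding fun I => Expr.holds_unlimitedAdding I rfl,
    Expr.polyTimeTuringReduces Expr.deleting fun I => Expr.holds_deleting I rfl⟩
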